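/- For a real polynomial $h$ in $n$ variables let $\|h\|_2 := \sup_{x\in\mathbb{R}^n,\ \|x\|_2=1}|h(x)|$. For a homogeneous polynomial $h$ of even degree $d$, a symmetric real matrix $M$ with rows and columns indexed by $[n]^{d/2}$ is called a matrix representation of $h$ if $(x^{\otimes d/2})^{T} M\, x^{\otimes d/2} = h(x)$ for all $x\in\mathbb{R}^n$, and $\|h\|_{sp}$ denotes the infimum of the spectral norms $\|M\|_2$ over all matrix representations $M$ of $h$. For a graph $G$ on the vertex set $[n]$ let $$f_G(x_1,\dots,x_n) := \sum_{\{i_1,i_2,i_3,i_4\}} x_{i_1}x_{i_2}x_{i_3}x_{i_4},$$ where the sum is over the $4$-cliques of $G$; this is a degree-$4$ homogeneous polynomial with non-negative coefficients. **Theorem.** There are absolute constants $C$ and $K$ such that for every $n\ge 2$ the following holds. Let $G\sim G_{n,p}$ be the random graph on $[n]$ with edge probability $p=n^{-1/3}$, and let $f=f_G$. Then with probability at least $1-K/n$, for every positive integer $q$ divisible by $4$, $$\frac{\|f^{q/4}\|_{sp}}{\|f^{q/4}\|_2}\ \ge\ \frac{n^{q/24}}{(q\log n)^{Cq}} \qquad\text{and}\qquad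 \frac{\|f^{q/4}\|_{sp}^{4/q}}{\|f\|_2}\ \ge\ \frac{n^{1/6}}{(q\log n)^{C}}.$$ -/

import Mathlib

/-- The sup-norm `‖h‖₂ = sup_{‖x‖₂ = 1} |h(x)|` of a real polynomial in `n` variables over the
Euclidean unit sphere. -/
noncomputable def sphereNorm {n : ℕ} (h : MvPolynomial (Fin n) ℝ) : ℝ :=
  ⨆ x : Metric.sphere (0 : EuclideanSpace ℝ (Fin n)) 1,
    |MvPolynomial.eval (fun i => (x : EuclideanSpace ℝ (Fin n)) i) h|

/-- The tensor power `x^{⊗k}`, a vector indexed by the tuples in `[n]^k`. -/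
def tensorPower {n : ℕ} (k : ℕ) (x : Fin n → ℝ) : (Fin k → Fin n) → ℝ :=
  fun I => ∏ l, x (I l)

/-- `M` is a (symmetric) degree-`d` matrix representation of `h`, for even `d`:
`(x^{⊗d/2})ᵀ M x^{⊗d/2} = h(x)` for all `x`. -/
def IsMatrixRep {n : ℕ} (d : ℕ) (h : MvPolynomial (Fin n) ℝ)
    (M : Matrix (Fin (d / 2) → Fin n) (Fin (d / 2) → Fin n) ℝ) : Prop :=
  M.IsSymm ∧ ∀ x : Fin n → ℝ,
    tensorPower (d / 2) x ⬝ᵥ M.mulVec (tensorPower (d / 2) x) = MvPolynomial.eval x h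

/-- `‖h‖_sp` for a homogeneous polynomial `h` of even degree `d`: the infimum of the spectral
norms (the `ℓ²` operator norms) of the degree-`d` matrix representations of `h`. -/
noncomputable def spNorm {n : ℕ} (d : ℕ) (h : MvPolynomial (Fin n) ℝ) : ℝ :=
  sInf {r : ℝ | ∃ M : Matrix (Fin (d / 2) → Fin n) (Fin (d / 2) → Fin n) ℝ,
    IsMatrixRep d h M ∧ r = ‖Matrix.toEuclideanCLM (𝕜 := ℝ) M‖}

open Classical in
/-- The clique polynomial of a graph `G` on `[n]`: the sum of `x_{i₁} x_{i₂} x_{i₃} x_{i₄}` over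
the `4`-cliques `{i₁, i₂, i₃, i₄}` of `G`. -/
noncomputable def cliquePoly {n : ℕ} (G : SimpleGraph (Fin n)) : MvPolynomial (Fin n) ℝ :=
  ∑ s ∈ G.cliqueFinset 4, ∏ i ∈ s, MvPolynomial.X i

/-- The edge probability `p = n^{-1/3}`. -/
noncomputable def edgeProb (n : ℕ) : unitInterval :=
  ⟨(n : ℝ) ^ (-(1 / 3) : ℝ), by
    refine ⟨by positivity, ?_⟩
    rcases Nat.eq_zero_or_pos n with rfl | hn
    · rw [Nat.cast_zero, Real.zero_rpow (by norm_num)]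
      exact zero_le_one
    · exact Real.rpow_le_one_of_one_le_of_nonpos (by exact_mod_cast hn) (by norm_num)⟩

/-- The law of the random graph `G_{n,p}` on `[n]` with `p = n^{-1/3}`. -/
noncomputable def randomGraph (n : ℕ) : MeasureTheory.Measure (SimpleGraph (Fin n)) :=
  SimpleGraph.binomialRandom (Fin n) (edgeProb n)

/-!
Put `p = n ^ (-1 / 3)`. With probability `1 - O(1 / n)` every set of at most three vertices has at
most a logarithmic factor more common neighbours than expected, every pair of vertex sets `A`, `B`
spans at most a logarithmic factor more than `p |A| |B| + |A| + |B|` edges (both by exponential tail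
bounds), and there are at least a constant times `n ^ 2` four-cliques (Chebyshev).

Upper bound on the sup-norm: round the coordinates of a unit vector up to powers of two. The level
`2 ^ (-k)` has `O(4 ^ k)` vertices. A clique is a triangle on its three largest coordinates together
with a common neighbour of that triangle, so edge and neighbour counts bound the contribution of
each of the `O((log n) ^ 3)` triples of levels by a power of `log n`.

Lower bound on the spectral norm: if `M` represents `f ^ m`, its entries at the positions that
contribute to monomials of `f ^ m` sum to the value of `f ^ m` at the all-ones vector, which is the
`m`-th power of the number of four-cliques. By Cauchy–Schwarz the square of this sum is at most the
number of these positions times the number of columns they meet times `‖M‖ ^ 2`. Each such column is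
an ordering of a union of `m` subcliques with `2 * m` vertices in total. Weighting a subclique `u`
by `z ^ (-|u|)` with `z = n ^ (1 / 2)`, the subcliques of each size have total weight at most
`n ^ (2 / 3)`, so there are at most `(z ^ 2 * n ^ (2 / 3)) ^ m` columns. With `n ^ 2` four-cliques,
this gives `‖M‖ ^ 2 ≥ (n ^ (2 - 5 / 3)) ^ m`, all up to factors `(m * log n) ^ O(m)`.
-/

open MeasureTheory Finset
open scoped Classical SimpleGraph

section CompleteEdges

variable {V : Type*}

/-- The edge set of the complete graph on `S`. -/
noncomputable def completeEdges (S : Finset V) : Finset (Sym2 V) :=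
  S.offDiag.image fun x ↦ s(x.1, x.2)

theorem mk_mem_completeEdges {S : Finset V} {a b : V} :
    s(a, b) ∈ completeEdges S ↔ a ∈ S ∧ b ∈ S ∧ a ≠ b := by
  simp only [completeEdges, mem_image, mem_offDiag, Prod.exists, Sym2.eq_iff]
  grind

theorem not_isDiag_of_mem_completeEdges {S : Finset V} {e : Sym2 V} (he : e ∈ completeEdges S) :
    ¬ e.IsDiag := by
  induction e
  exact (mk_mem_completeEdges.1 he).2.2

theorem card_completeEdges (S : Finset V) : #(completeEdges S) = (#S).choose 2 :=
  Sym2.card_image_offDiag S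

theorem completeEdges_inter (S T : Finset V) :
    completeEdges S ∩ completeEdges T = completeEdges (S ∩ T) := by
  ext e
  induction e
  simp only [mem_inter, mk_mem_completeEdges]
  tauto

theorem completeEdges_subset_edgeSet_iff {G : SimpleGraph V} {S : Finset V} :
    (completeEdges S : Set (Sym2 V)) ⊆ G.edgeSet ↔ G.IsClique S := by
  refine ⟨fun h a ha b hb hab ↦ h (mk_mem_completeEdges.2 ⟨ha, hb, hab⟩), fun h e he ↦ ?_⟩
  induction e
  obtain ⟨ha, hb, hab⟩ := mk_mem_completeEdges.1 he
  exact h ha hb hab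

end CompleteEdges

section Probability

variable {V : Type*} {p : unitInterval}

instance [Countable V] : MeasurableSingletonClass (SimpleGraph V) where
  measurableSet_singleton G := by
    have hG : {G} = SimpleGraph.edgeSet ⁻¹' {G.edgeSet} := by ext H; simp
    rw [hG]
    exact SimpleGraph.measurableEmbedding_edgeSet.measurable (measurableSet_singleton _)

theorem binomialRandom_real_subset_edgeSet [Finite V] (F : Finset (Sym2 V))
    (hF : ∀ e ∈ F, ¬ e.IsDiag) :
    G(V, p).real {G | (F : Set (Sym2 V)) ⊆ G.edgeSet} = (p : ℝ) ^ #F := by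
  have hpre : (fun P : Sym2 V → Prop ↦ {e | P e}) ⁻¹' (SimpleGraph.fromEdgeSet ⁻¹'
      {G | (F : Set (Sym2 V)) ⊆ G.edgeSet}) = Set.pi F fun _ ↦ {True} := by
    ext P
    simp only [Set.mem_preimage, Set.mem_pi, SimpleGraph.edgeSet_fromEdgeSet, Set.mem_ofPred_eq]
    exact ⟨fun h e he ↦ by simpa using (h he).1,
      fun h e he ↦ ⟨by simpa using h e he, by simpa using hF e he⟩⟩
  rw [measureReal_def, SimpleGraph.binomialRandom_eq_map,
    Measure.map_apply SimpleGraph.measurable_fromEdgeSet (Set.toFinite _).measurableSet,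
    ProbabilityTheory.setBernoulli_apply', hpre,
    Measure.infinitePi_pi _ fun _ _ ↦ MeasurableSet.of_discrete,
    prod_eq_pow_card (b := (unitInterval.toNNReal p : ENNReal)) fun e he ↦ by simp [hF e he]]
  simp

theorem binomialRandom_real_isClique [Finite V] (S : Finset V) :
    G(V, p).real {G | G.IsClique S} = (p : ℝ) ^ (#S).choose 2 := by
  simp_rw [← completeEdges_subset_edgeSet_iff, ← card_completeEdges]
  exact binomialRandom_real_subset_edgeSet _ fun e he ↦ not_isDiag_of_mem_completeEdges he

theorem binomialRandom_real_isClique_inter_isClique [Finite V] (S T : Finset V) :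
    G(V, p).real ({G | G.IsClique S} ∩ {G | G.IsClique T}) =
      (p : ℝ) ^ ((#S).choose 2 + (#T).choose 2 - (#(S ∩ T)).choose 2) := by
  have hinter : ({G : SimpleGraph V | G.IsClique S} ∩ {G | G.IsClique T}) =
      {G | ((completeEdges S ∪ completeEdges T : Finset _) : Set (Sym2 V)) ⊆ G.edgeSet} := by
    ext G
    simp [← completeEdges_subset_edgeSet_iff]
  rw [hinter, binomialRandom_real_subset_edgeSet, card_union, completeEdges_inter,
    card_completeEdges, card_completeEdges, card_completeEdges]
  intro e he
  rcases mem_union.1 he with he | he <;> exact not_isDiag_of_mem_completeEdges he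

theorem choose_mul_pow_le_exp_neg {N t : ℕ} {r : ℝ} (hr : 0 ≤ r) (ht : 9 * (N * r) ≤ t) :
    N.choose t * r ^ t ≤ Real.exp (-t) := by
  have exp_two_le : Real.exp 2 ≤ 9 := by
    rw [show (2 : ℝ) = 1 + 1 by norm_num, Real.exp_add]
    nlinarith [Real.exp_one_lt_three, Real.exp_pos 1]
  have hNr : N * r ≤ t * Real.exp (-2) := by
    rw [Real.exp_neg, ← div_eq_mul_inv, le_div_iff₀ (Real.exp_pos 2)]
    nlinarith [mul_nonneg N.cast_nonneg hr]
  calc N.choose t * r ^ t ≤ (N : ℝ) ^ t / t.factorial * r ^ t := by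
        gcongr; exact Nat.choose_le_pow_div t N
    _ = (N * r) ^ t / t.factorial := by rw [mul_pow]; ring
    _ ≤ (t * Real.exp (-2)) ^ t / t.factorial := by gcongr
    _ = (t : ℝ) ^ t / t.factorial * Real.exp (-2) ^ t := by rw [mul_pow]; ring
    _ ≤ Real.exp t * Real.exp (-2) ^ t := by
        gcongr; exact Real.pow_div_factorial_le_exp _ (by positivity) _
    _ = Real.exp (-t) := by
        rw [← Real.exp_nat_mul, ← Real.exp_add]
        ring_nf

theorem binomialRandom_real_le_card_filter_subset_edgeSet_le [Finite V] {ι : Type*}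
    {s : Finset ι} {F : ι → Finset (Sym2 V)} {k : ℕ} (hdiag : ∀ i ∈ s, ∀ e ∈ F i, ¬ e.IsDiag)
    (hcard : ∀ i ∈ s, #(F i) = k) (hdisj : (s : Set ι).PairwiseDisjoint F) {t : ℝ}
    (ht : 9 * (#s * (p : ℝ) ^ k) ≤ t) :
    G(V, p).real {G | t ≤ #{i ∈ s | (F i : Set (Sym2 V)) ⊆ G.edgeSet}} ≤ Real.exp (-t) := by
  have hp : (0 : ℝ) ≤ p := p.2.1
  have hsub : {G : SimpleGraph V | t ≤ #{i ∈ s | (F i : Set (Sym2 V)) ⊆ G.edgeSet}} ⊆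
      ⋃ T ∈ s.powersetCard ⌈t⌉₊, {G | (T.biUnion F : Set (Sym2 V)) ⊆ G.edgeSet} := by
    rintro G (hG : t ≤ _)
    obtain ⟨T, hT, hTcard⟩ := exists_subset_card_eq (Nat.ceil_le.2 hG)
    simp only [Set.mem_iUnion, mem_powersetCard]
    refine ⟨T, ⟨hT.trans (filter_subset _ _), hTcard⟩, ?_⟩
    simpa using fun i hi ↦ (mem_filter.1 (hT hi)).2
  have hprob : ∀ T ∈ s.powersetCard ⌈t⌉₊,
      G(V, p).real {G | (T.biUnion F : Set (Sym2 V)) ⊆ G.edgeSet} = ((p : ℝ) ^ k) ^ ⌈t⌉₊ := by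
    intro T hT
    obtain ⟨hTs, hTcard⟩ := mem_powersetCard.1 hT
    rw [binomialRandom_real_subset_edgeSet, card_biUnion fun i hi j hj ↦ hdisj (hTs hi) (hTs hj),
      sum_const_nat fun i hi ↦ hcard i (hTs hi), hTcard, mul_comm, pow_mul]
    exact fun e he ↦ let ⟨i, hi, hei⟩ := mem_biUnion.1 he; hdiag i (hTs hi) e hei
  calc G(V, p).real {G | t ≤ #{i ∈ s | (F i : Set (Sym2 V)) ⊆ G.edgeSet}}
      ≤ ∑ T ∈ s.powersetCard ⌈t⌉₊, G(V, p).real {G | (T.biUnion F : Set (Sym2 V)) ⊆ G.edgeSet} :=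
        (measureReal_mono hsub (measure_ne_top _ _)).trans (measureReal_biUnion_finset_le _ _)
    _ = (#s).choose ⌈t⌉₊ * ((p : ℝ) ^ k) ^ ⌈t⌉₊ := by
        rw [sum_congr rfl hprob, sum_const, card_powersetCard, nsmul_eq_mul]
    _ ≤ Real.exp (-⌈t⌉₊) := choose_mul_pow_le_exp_neg (by positivity) (ht.trans (Nat.le_ceil t))
    _ ≤ Real.exp (-t) := by gcongr; exact Nat.le_ceil t

theorem binomialRandom_real_two_mul_le_card_interedges_le [Finite V] (A B : Finset V)
    {t : ℝ} (ht : 9 * (#A * #B * (p : ℝ)) ≤ t) :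
    G(V, p).real {G | 2 * t ≤ #(G.interedges A B)} ≤ Real.exp (-t) := by
  have hp : (0 : ℝ) ≤ p := p.2.1
  let pairs : Finset (Sym2 V) := {x ∈ A ×ˢ B | x.1 ≠ x.2}.image fun x ↦ s(x.1, x.2)
  let F (e : Sym2 V) : Finset (Sym2 V) := {e}
  have card_le (G : SimpleGraph V) : #(G.interedges A B) ≤
      2 * #{e ∈ pairs | (F e : Set (Sym2 V)) ⊆ G.edgeSet} := by
    refine card_le_mul_card_image_of_maps_to (f := fun x : V × V ↦ s(x.1, x.2)) (fun x hx ↦ ?_) 2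
      fun e _ ↦ ?_
    · obtain ⟨hA, hB, hx⟩ := G.mem_interedges_iff.1 hx
      simp only [pairs, F, mem_filter, mem_image, mem_product, coe_singleton,
        Set.singleton_subset_iff]
      exact ⟨⟨x, ⟨⟨hA, hB⟩, hx.ne⟩, rfl⟩, hx⟩
    · induction e with | _ a b
      refine (card_le_card (t := {(a, b), (b, a)}) fun x hx ↦ ?_).trans card_le_two
      simpa [Prod.ext_iff] using (mem_filter.1 hx).2
  calc G(V, p).real {G | 2 * t ≤ #(G.interedges A B)}
      ≤ G(V, p).real {G | t ≤ #{e ∈ pairs | (F e : Set (Sym2 V)) ⊆ G.edgeSet}} :=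
        measureReal_mono fun G (hG : 2 * t ≤ _) ↦ by
          rw [Set.mem_ofPred_eq]
          have := Nat.cast_le (α := ℝ).2 (card_le G)
          push_cast at this
          linarith
    _ ≤ Real.exp (-t) := by
        refine binomialRandom_real_le_card_filter_subset_edgeSet_le (k := 1) ?_
          (fun e _ ↦ card_singleton e) (fun e _ e' _ hne ↦ disjoint_singleton.2 hne) ?_
        · simp only [pairs, mem_image, mem_filter, mem_singleton, forall_eq]
          rintro _ ⟨x, ⟨-, hx⟩, rfl⟩
          exact hx
        · refine le_trans ?_ ht
          rw [pow_one, ← Nat.cast_mul, ← card_product]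
          gcongr
          exact card_image_le.trans (card_filter_le _ _)

variable [Fintype V]

/-- The set of vertices adjacent to every vertex of `S`. It is all of `V` when `S` is empty. -/
noncomputable def commonNeighborFinset (G : SimpleGraph V) (S : Finset V) : Finset V :=
  {u | ∀ v ∈ S, G.Adj v u}

theorem mem_commonNeighborFinset {G : SimpleGraph V} {S : Finset V} {u : V} :
    u ∈ commonNeighborFinset G S ↔ ∀ v ∈ S, G.Adj v u := by
  simp [commonNeighborFinset]

theorem binomialRandom_real_le_card_commonNeighborFinset_le (S : Finset V) {t : ℝ}
    (ht : 9 * (Fintype.card V * (p : ℝ) ^ #S) ≤ t) :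
    G(V, p).real {G | t ≤ #(commonNeighborFinset G S)} ≤ Real.exp (-t) := by
  have hp : (0 : ℝ) ≤ p := p.2.1
  let star (u : V) : Finset (Sym2 V) := S.image fun v ↦ s(v, u)
  have star_subset_iff (G : SimpleGraph V) (u : V) :
      (star u : Set (Sym2 V)) ⊆ G.edgeSet ↔ ∀ v ∈ S, G.Adj v u := by
    simp [star, Set.subset_def]
  have filter_star (G : SimpleGraph V) :
      {u ∈ Sᶜ | (star u : Set (Sym2 V)) ⊆ G.edgeSet} = commonNeighborFinset G S := by
    ext u
    rw [mem_filter, star_subset_iff, mem_commonNeighborFinset, mem_compl, and_iff_right_iff_imp]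
    exact fun hu huS ↦ G.irrefl (hu u huS)
  simp_rw [← filter_star]
  refine binomialRandom_real_le_card_filter_subset_edgeSet_le (k := #S) ?_ ?_ ?_ ?_
  · rintro u hu e he
    obtain ⟨v, hv, rfl⟩ := mem_image.1 he
    exact fun h ↦ mem_compl.1 hu (Sym2.mk_isDiag_iff.1 h ▸ hv)
  · exact fun u _ ↦ card_image_of_injective _ fun v w h ↦ Sym2.congr_left.1 h
  · refine fun u hu u' _ hne ↦ disjoint_left.2 fun e he he' ↦ ?_
    obtain ⟨v, -, rfl⟩ := mem_image.1 he
    obtain ⟨w, hw, hvw⟩ := mem_image.1 he'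
    rcases Sym2.eq_iff.1 hvw with h | h
    · exact hne h.2.symm
    · exact mem_compl.1 (mem_coe.1 hu) (h.1 ▸ hw)
  · refine le_trans ?_ ht
    gcongr
    exact card_le_univ _

theorem sum_inv_card_pow_card_le_exp_one [Nonempty V] :
    ∑ S : Finset V, ((Fintype.card V : ℝ) ^ #S)⁻¹ ≤ Real.exp 1 := by
  set N := (Fintype.card V : ℝ)
  calc ∑ S : Finset V, (N ^ #S)⁻¹ = (1 + N⁻¹) ^ Fintype.card V := by
        have := prod_one_add (f := fun _ : V ↦ N⁻¹) univ
        simp only [prod_const, card_univ, powerset_univ, inv_pow] at this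
        exact this.symm
    _ ≤ Real.exp N⁻¹ ^ Fintype.card V := by
        gcongr
        rw [add_comm]
        exact Real.add_one_le_exp _
    _ = Real.exp 1 := by
        rw [← Real.exp_nat_mul, mul_inv_cancel₀]
        exact Nat.cast_ne_zero.2 Fintype.card_ne_zero

theorem exp_neg_le_inv_pow_of_mul_log_le {N : ℝ} (hN : 0 < N) {k : ℕ} {t : ℝ}
    (ht : k * Real.log N ≤ t) : Real.exp (-t) ≤ (N ^ k)⁻¹ := by
  rw [Real.exp_neg, ← Real.exp_log (pow_pos hN k), Real.log_pow]
  gcongr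

theorem binomialRandom_real_exists_le_card_commonNeighborFinset_le [Nonempty V] :
    G(V, p).real {G | ∃ S : Finset V, 9 * (Fintype.card V * (p : ℝ) ^ #S) +
      (#S + 1) * Real.log (Fintype.card V) ≤ #(commonNeighborFinset G S)} ≤
      Real.exp 1 / Fintype.card V := by
  have hp : (0 : ℝ) ≤ p := p.2.1
  set N := (Fintype.card V : ℝ)
  have hN : 0 < N := Nat.cast_pos.2 Fintype.card_pos
  have hlog : 0 ≤ Real.log N := Real.log_natCast_nonneg _
  calc _ ≤ ∑ S : Finset V, G(V, p).real {G | 9 * (N * (p : ℝ) ^ #S) +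
          (#S + 1) * Real.log N ≤ #(commonNeighborFinset G S)} := by
        rw [Set.ofPred_exists]
        exact measureReal_iUnion_fintype_le _
    _ ≤ ∑ S : Finset V, (N ^ #S)⁻¹ * N⁻¹ := by
        refine sum_le_sum fun S _ ↦ ?_
        refine (binomialRandom_real_le_card_commonNeighborFinset_le S
          (le_add_of_nonneg_right (by positivity))).trans ?_
        rw [← mul_inv, ← pow_succ]
        refine exp_neg_le_inv_pow_of_mul_log_le hN ?_
        push_cast
        exact le_add_of_nonneg_left (by positivity)
    _ = (∑ S : Finset V, (N ^ #S)⁻¹) / N := by rw [← sum_mul, div_eq_mul_inv]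
    _ ≤ Real.exp 1 / N := by gcongr; exact sum_inv_card_pow_card_le_exp_one

theorem binomialRandom_real_exists_le_card_interedges_le [Nonempty V] :
    G(V, p).real {G | ∃ A B : Finset V, 2 * (9 * (#A * #B * (p : ℝ)) +
      (#A + #B + 1) * Real.log (Fintype.card V)) ≤ #(G.interedges A B)} ≤
      Real.exp 1 ^ 2 / Fintype.card V := by
  have hp : (0 : ℝ) ≤ p := p.2.1
  set N := (Fintype.card V : ℝ)
  have hN : 0 < N := Nat.cast_pos.2 Fintype.card_pos
  have hlog : 0 ≤ Real.log N := Real.log_natCast_nonneg _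
  have hsum : 0 ≤ ∑ S : Finset V, (N ^ #S)⁻¹ := by positivity
  calc _ ≤ ∑ A : Finset V, ∑ B : Finset V, G(V, p).real {G | 2 * (9 * (#A * #B * (p : ℝ)) +
          (#A + #B + 1) * Real.log N) ≤ #(G.interedges A B)} := by
        simp_rw [Set.ofPred_exists]
        exact (measureReal_iUnion_fintype_le _).trans
          (sum_le_sum fun A _ ↦ measureReal_iUnion_fintype_le _)
    _ ≤ ∑ A : Finset V, ∑ B : Finset V, (N ^ #A)⁻¹ * (N ^ #B)⁻¹ * N⁻¹ := by
        refine sum_le_sum fun A _ ↦ sum_le_sum fun B _ ↦ ?_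
        refine (binomialRandom_real_two_mul_le_card_interedges_le A B
          (le_add_of_nonneg_right (by positivity))).trans ?_
        rw [← mul_inv, ← pow_add, ← mul_inv, ← pow_succ]
        refine exp_neg_le_inv_pow_of_mul_log_le hN ?_
        push_cast
        exact le_add_of_nonneg_left (by positivity)
    _ = (∑ S : Finset V, (N ^ #S)⁻¹) ^ 2 / N := by
        simp_rw [← sum_mul, ← mul_sum, ← sum_mul, sq, div_eq_mul_inv]
    _ ≤ Real.exp 1 ^ 2 / N := by gcongr; exact sum_inv_card_pow_card_le_exp_one

open ProbabilityTheory in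
theorem sq_half_mul_measureReal_card_filter_le_half_le {Ω ι : Type*} [MeasurableSpace Ω]
    {μ : Measure Ω} [IsProbabilityMeasure μ] {s : Finset ι} {E : ι → Set Ω}
    (hE : ∀ i ∈ s, MeasurableSet (E i)) :
    ((∑ i ∈ s, μ.real (E i)) / 2) ^ 2 *
        μ.real {ω | #{i ∈ s | ω ∈ E i} ≤ (∑ i ∈ s, μ.real (E i)) / 2} ≤
      ∑ i ∈ s, ∑ j ∈ s, (μ.real (E i ∩ E j) - μ.real (E i) * μ.real (E j)) := by
  let X (i : ι) : Ω → ℝ := (E i).indicator 1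
  have hX : ∀ i ∈ s, MemLp (X i) 2 μ := fun i hi ↦
    memLp_indicator_const 2 (hE i hi) (1 : ℝ) (Or.inr (measure_ne_top μ _))
  have count_eq (ω : Ω) : (#{i ∈ s | ω ∈ E i} : ℝ) = ∑ i ∈ s, X i ω := by
    simp [X, Set.indicator_apply]
  have expect_count : ∫ ω, ∑ i ∈ s, X i ω ∂μ = ∑ i ∈ s, μ.real (E i) := by
    rw [integral_finsetSum _ fun i hi ↦ (hX i hi).integrable one_le_two]
    exact sum_congr rfl fun i hi ↦ integral_indicator_one (hE i hi)
  have cov_eq : ∀ i ∈ s, ∀ j ∈ s,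
      cov[X i, X j; μ] = μ.real (E i ∩ E j) - μ.real (E i) * μ.real (E j) := fun i hi j hj ↦ by
    rw [covariance_eq_sub (hX i hi) (hX j hj), ← Set.inter_indicator_one,
      integral_indicator_one ((hE i hi).inter (hE j hj)), integral_indicator_one (hE i hi),
      integral_indicator_one (hE j hj)]
  have variance_eq : ∫ ω, (∑ i ∈ s, X i ω - ∑ i ∈ s, μ.real (E i)) ^ 2 ∂μ =
      ∑ i ∈ s, ∑ j ∈ s, (μ.real (E i ∩ E j) - μ.real (E i) * μ.real (E j)) := by
    rw [← sum_congr rfl fun i hi ↦ sum_congr rfl (cov_eq i hi),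
      ← covariance_fun_sum_fun_sum' hX hX, covariance, expect_count]
    simp_rw [sq]
  rw [← variance_eq]
  refine (mul_le_mul_of_nonneg_left (measureReal_mono fun ω hω ↦ ?_) (sq_nonneg _)).trans
    (mul_meas_ge_le_integral_of_nonneg (.of_forall fun ω ↦ sq_nonneg _)
      ((memLp_finsetSum s hX).sub (memLp_const _)).integrable_sq _)
  have hmean : 0 ≤ ∑ i ∈ s, μ.real (E i) := sum_nonneg fun i _ ↦ measureReal_nonneg
  rw [Set.mem_ofPred_eq, count_eq] at hω
  change _ ≤ (∑ i ∈ s, X i ω - ∑ i ∈ s, μ.real (E i)) ^ 2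
  nlinarith

theorem covariance_isClique_four_le [Nonempty V] (hp : (p : ℝ) ^ 3 = (Fintype.card V : ℝ)⁻¹)
    {S T : Finset V} (hS : #S = 4) (hT : #T = 4) :
    G(V, p).real ({G | G.IsClique S} ∩ {G | G.IsClique T}) -
        G(V, p).real {G | G.IsClique S} * G(V, p).real {G | G.IsClique T} ≤
      (Fintype.card V : ℝ) ^ #(S ∩ T) / (Fintype.card V : ℝ) ^ 5 := by
  have hp0 : (0 : ℝ) ≤ p := p.2.1
  have hj : #(S ∩ T) ≤ 4 := hS ▸ card_le_card inter_subset_left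
  rw [binomialRandom_real_isClique_inter_isClique, binomialRandom_real_isClique,
    binomialRandom_real_isClique, hS, hT, ← pow_add, show (4 : ℕ).choose 2 = 6 from rfl]
  generalize #(S ∩ T) = j at hj ⊢
  rcases Nat.lt_or_ge j 2 with hj2 | hj2
  · rw [Nat.choose_eq_zero_of_lt hj2, Nat.sub_zero, sub_self]
    positivity
  · have exponent_le : 3 * (5 - j) ≤ 6 + 6 - j.choose 2 := by
      interval_cases j <;> decide
    calc (p : ℝ) ^ (6 + 6 - j.choose 2) - (p : ℝ) ^ (6 + 6)
        ≤ (p : ℝ) ^ (3 * (5 - j)) :=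
          (sub_le_self _ (by positivity)).trans (pow_le_pow_of_le_one hp0 p.2.2 exponent_le)
      _ = (Fintype.card V : ℝ) ^ j / (Fintype.card V : ℝ) ^ 5 := by
          have hN : (Fintype.card V : ℝ) ≠ 0 := Nat.cast_ne_zero.2 Fintype.card_ne_zero
          rw [pow_mul, hp, inv_pow, eq_div_iff (pow_ne_zero 5 hN), ← Nat.sub_add_cancel
            (show j ≤ 5 by omega), pow_add, Nat.sub_add_cancel (show j ≤ 5 by omega),
            inv_mul_cancel_left₀ (pow_ne_zero _ hN)]

theorem sum_card_pow_card_inter_le (k : ℕ) (S : Finset V) :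
    ∑ T ∈ powersetCard k (univ : Finset V), Fintype.card V ^ #(S ∩ T) ≤
      2 ^ #S * Fintype.card V ^ k := by
  have card_fiber_le : ∀ U ∈ S.powerset, #{T ∈ powersetCard k univ | S ∩ T = U} *
      Fintype.card V ^ #U ≤ Fintype.card V ^ k := by
    intro U _
    rcases Nat.lt_or_ge k #U with hk | hk
    · rw [filter_false_of_mem, card_empty, zero_mul]
      · exact Nat.zero_le _
      · rintro T hT rfl
        exact hk.not_ge ((mem_powersetCard.1 hT).2 ▸ card_le_card inter_subset_right)
    calc _ ≤ #(powersetCard (k - #U) (univ : Finset V)) * Fintype.card V ^ #U := by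
          refine Nat.mul_le_mul_right _ ?_
          refine card_le_card_of_injOn (· \ S) (fun T hT ↦ ?_) fun T hT T' hT' h ↦ ?_
          · obtain ⟨hTk, rfl⟩ := mem_filter.1 hT
            rw [mem_coe, mem_powersetCard, card_sdiff, (mem_powersetCard.1 hTk).2]
            exact ⟨subset_univ _, rfl⟩
          · rw [← sdiff_union_inter T S, ← sdiff_union_inter T' S, inter_comm T, inter_comm T',
              (mem_filter.1 hT).2, (mem_filter.1 hT').2]
            exact congrArg (· ∪ U) h
      _ ≤ Fintype.card V ^ (k - #U) * Fintype.card V ^ #U := by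
          gcongr
          rw [card_powersetCard]
          exact Nat.choose_le_pow _ _
      _ = Fintype.card V ^ k := by rw [← pow_add, Nat.sub_add_cancel hk]
  calc ∑ T ∈ powersetCard k (univ : Finset V), Fintype.card V ^ #(S ∩ T)
      = ∑ U ∈ S.powerset, #{T ∈ powersetCard k univ | S ∩ T = U} * Fintype.card V ^ #U := by
        rw [← sum_fiberwise_of_maps_to fun T _ ↦ mem_powerset.2 (inter_subset_left (s₂ := T))]
        refine sum_congr rfl fun _ _ ↦ sum_const_nat fun T hT ↦ ?_
        rw [(mem_filter.1 hT).2]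
    _ ≤ ∑ _U ∈ S.powerset, Fintype.card V ^ k := sum_le_sum card_fiber_le
    _ = 2 ^ #S * Fintype.card V ^ k := by rw [sum_const, card_powerset, smul_eq_mul]

theorem pow_four_le_choose_four {n : ℕ} (hn : 6 ≤ n) : (n : ℝ) ^ 4 / 384 ≤ n.choose 4 := by
  have hn' : (6 : ℝ) ≤ n := by exact_mod_cast hn
  have hcast : ((n + 1 - 4 : ℕ) : ℝ) = n - 3 := by
    rw [show n + 1 - 4 = n - 3 by omega, Nat.cast_sub (by omega), Nat.cast_ofNat]
  calc (n : ℝ) ^ 4 / 384 = ((n : ℝ) / 2) ^ 4 / 24 := by ring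
    _ ≤ ((n : ℝ) - 3) ^ 4 / 24 := by gcongr; linarith
    _ = ((n + 1 - 4 : ℕ) : ℝ) ^ 4 / Nat.factorial 4 := by rw [hcast]; norm_num [Nat.factorial]
    _ ≤ n.choose 4 := Nat.pow_le_choose 4 n

theorem sum_covariance_isClique_four_le [Nonempty V]
    (hp : (p : ℝ) ^ 3 = (Fintype.card V : ℝ)⁻¹) :
    ∑ S ∈ powersetCard 4 (univ : Finset V), ∑ T ∈ powersetCard 4 (univ : Finset V),
      (G(V, p).real ({G | G.IsClique S} ∩ {G | G.IsClique T}) -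
        G(V, p).real {G | G.IsClique S} * G(V, p).real {G | G.IsClique T}) ≤
      16 * (Fintype.card V : ℝ) ^ 3 := by
  have hN : (Fintype.card V : ℝ) ≠ 0 := Nat.cast_ne_zero.2 Fintype.card_ne_zero
  have card_eq {S : Finset V} (hS : S ∈ powersetCard 4 univ) : #S = 4 := (mem_powersetCard.1 hS).2
  calc _ ≤ ∑ S ∈ powersetCard 4 (univ : Finset V), ∑ T ∈ powersetCard 4 (univ : Finset V),
          (Fintype.card V : ℝ) ^ #(S ∩ T) / (Fintype.card V : ℝ) ^ 5 :=
        sum_le_sum fun S hS ↦ sum_le_sum fun T hT ↦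
          covariance_isClique_four_le hp (card_eq hS) (card_eq hT)
    _ ≤ ∑ S ∈ powersetCard 4 (univ : Finset V),
          2 ^ 4 * (Fintype.card V : ℝ) ^ 4 / (Fintype.card V : ℝ) ^ 5 := by
        refine sum_le_sum fun S hS ↦ ?_
        rw [← sum_div]
        gcongr
        exact_mod_cast card_eq hS ▸ sum_card_pow_card_inter_le 4 S
    _ = (Fintype.card V).choose 4 * (16 / Fintype.card V) := by
        rw [sum_const, card_powersetCard, card_univ, nsmul_eq_mul]
        field_simp
        norm_num
    _ ≤ (Fintype.card V : ℝ) ^ 4 * (16 / Fintype.card V) := by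
        gcongr
        exact_mod_cast Nat.choose_le_pow (Fintype.card V) 4
    _ = 16 * (Fintype.card V : ℝ) ^ 3 := by field_simp

theorem binomialRandom_real_card_cliqueFinset_four_le_le [DecidableEq V]
    (hp : (p : ℝ) ^ 3 = (Fintype.card V : ℝ)⁻¹) (hV : 6 ≤ Fintype.card V) :
    G(V, p).real {G | #(G.cliqueFinset 4) ≤ (Fintype.card V : ℝ) ^ 2 / 768} ≤
      9437184 / Fintype.card V := by
  have : Nonempty V := Fintype.card_pos_iff.1 (by omega)
  have hN : 0 < (Fintype.card V : ℝ) := Nat.cast_pos.2 Fintype.card_pos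
  let cliqueEvent (S : Finset V) : Set (SimpleGraph V) := {G | G.IsClique S}
  have count_eq (G : SimpleGraph V) :
      #(G.cliqueFinset 4) = #{S ∈ powersetCard 4 univ | G ∈ cliqueEvent S} := by
    refine congrArg card ?_
    ext S
    simp [cliqueEvent, SimpleGraph.isNClique_iff, and_comm]
  have mean_eq : ∑ S ∈ powersetCard 4 univ, G(V, p).real (cliqueEvent S) =
      (Fintype.card V).choose 4 / (Fintype.card V : ℝ) ^ 2 := by
    rw [sum_congr rfl fun S hS ↦ ?_, sum_const, card_powersetCard, card_univ, nsmul_eq_mul,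
      div_eq_mul_inv]
    rw [binomialRandom_real_isClique, (mem_powersetCard.1 hS).2, ← inv_pow, ← hp, ← pow_mul]
    rfl
  have le_half_mean : (Fintype.card V : ℝ) ^ 2 / 768 ≤
      (Fintype.card V).choose 4 / (Fintype.card V : ℝ) ^ 2 / 2 :=
    calc (Fintype.card V : ℝ) ^ 2 / 768
        = (Fintype.card V : ℝ) ^ 4 / 384 / (Fintype.card V : ℝ) ^ 2 / 2 := by field_simp; norm_num
      _ ≤ _ := by gcongr; exact pow_four_le_choose_four hV
  have chebyshev : ((Fintype.card V).choose 4 / (Fintype.card V : ℝ) ^ 2 / 2) ^ 2 *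
      G(V, p).real {G | #(G.cliqueFinset 4) ≤
        (Fintype.card V).choose 4 / (Fintype.card V : ℝ) ^ 2 / 2} ≤
      16 * (Fintype.card V : ℝ) ^ 3 := by
    simp_rw [count_eq, ← mean_eq]
    convert! (sq_half_mul_measureReal_card_filter_le_half_le fun S _ ↦ .of_discrete).trans
      (sum_covariance_isClique_four_le hp)
  rw [le_div_iff₀ hN]
  refine le_of_mul_le_mul_right ?_ (pow_pos hN 3)
  calc _ = 589824 * (((Fintype.card V : ℝ) ^ 2 / 768) ^ 2 *
          G(V, p).real {G | #(G.cliqueFinset 4) ≤ (Fintype.card V : ℝ) ^ 2 / 768}) := by ring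
    _ ≤ 589824 * (16 * (Fintype.card V : ℝ) ^ 3) := by
        refine mul_le_mul_of_nonneg_left (le_trans ?_ chebyshev) (by norm_num)
        exact mul_le_mul (pow_le_pow_left₀ (by positivity) le_half_mean 2)
          (measureReal_mono (fun G (hG : _ ≤ _) ↦ hG.trans le_half_mean) (measure_ne_top _ _))
          measureReal_nonneg (by positivity)
    _ = 9437184 * (Fintype.card V : ℝ) ^ 3 := by ring

end Probability

section Pseudorandom

variable {V : Type*} {G : SimpleGraph V}

/-- The triples in `A × B × C` that span a triangle of `G`. -/
noncomputable def triangleTriples (G : SimpleGraph V) (A B C : Finset V) : Finset (V × V × V) :=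
  {x ∈ A ×ˢ B ×ˢ C | G.Adj x.1 x.2.1 ∧ G.Adj x.1 x.2.2 ∧ G.Adj x.2.1 x.2.2}

theorem mem_triangleTriples {A B C : Finset V} {x : V × V × V} :
    x ∈ triangleTriples G A B C ↔ (x.1 ∈ A ∧ x.2.1 ∈ B ∧ x.2.2 ∈ C) ∧
      G.Adj x.1 x.2.1 ∧ G.Adj x.1 x.2.2 ∧ G.Adj x.2.1 x.2.2 := by
  simp [triangleTriples]

theorem card_interedges_eq_sum_card_filter (A B : Finset V) :
    #(G.interedges A B) = ∑ b ∈ B, #{a ∈ A | G.Adj a b} := by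
  simp only [SimpleGraph.interedges, Rel.interedges, card_filter, sum_product_right]

theorem card_triangleTriples_le_sum_card_interedges (A B C : Finset V) :
    #(triangleTriples G A B C) ≤
      ∑ c ∈ C, #(G.interedges {a ∈ A | G.Adj a c} {b ∈ B | G.Adj b c}) := by
  rw [← card_sigma]
  refine card_le_card_of_injOn (fun x ↦ ⟨x.2.2, (x.1, x.2.1)⟩) (fun x hx ↦ ?_) ?_
  · obtain ⟨⟨hA, hB, hC⟩, hAB, hAC, hBC⟩ := mem_triangleTriples.1 hx
    simp [SimpleGraph.mem_interedges_iff, hA, hB, hC, hAB, hAC, hBC]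
  · rintro ⟨a, b, c⟩ _ ⟨a', b', c'⟩ _ h
    simp only [Sigma.mk.injEq, Prod.mk.injEq, heq_eq_eq] at h
    simp [h]

variable [Fintype V] {θ L : ℝ}

theorem card_interedges_le_sum_card_commonNeighborFinset (A B : Finset V) :
    #(G.interedges A B) ≤ ∑ a ∈ A, #(commonNeighborFinset G {a}) := by
  simp only [SimpleGraph.interedges, Rel.interedges, card_filter, sum_product]
  gcongr with a
  rw [← card_filter]
  refine card_le_card fun b hb ↦ ?_
  simpa [mem_commonNeighborFinset] using (mem_filter.1 hb).2

theorem card_triangleTriples_le_sum_card_commonNeighborFinset (A B C : Finset V) :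
    #(triangleTriples G A B C) ≤
      ∑ x ∈ G.interedges A B, #(commonNeighborFinset G {x.1, x.2}) := by
  rw [← card_sigma]
  refine card_le_card_of_injOn (fun x ↦ ⟨(x.1, x.2.1), x.2.2⟩) (fun x hx ↦ ?_) ?_
  · obtain ⟨⟨hA, hB, -⟩, hAB, hAC, hBC⟩ := mem_triangleTriples.1 hx
    simp [mem_commonNeighborFinset, SimpleGraph.mem_interedges_iff, hA, hB, hAB, hAC, hBC]
  · rintro ⟨a, b, c⟩ _ ⟨a', b', c'⟩ _ h
    simpa [and_assoc] using h

/-- The properties of a random graph of order `θ ^ 3` and edge density `1 / θ`, up to a factor `L`: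
small sets of vertices do not have many more common neighbours than expected, and the
numbers of edges between two sets are not much larger than expected. -/
structure IsPseudorandom (G : SimpleGraph V) (θ L : ℝ) : Prop where
  pos : 0 < θ
  card_commonNeighborFinset_le (S : Finset V) (hS : #S ≤ 3) :
    (#(commonNeighborFinset G S) : ℝ) ≤ L * θ ^ (3 - #S)
  card_interedges_le (A B : Finset V) :
    (#(G.interedges A B) : ℝ) ≤ L * (#A * #B / θ + #A + #B)

namespace IsPseudorandom

theorem nonneg (hG : IsPseudorandom G θ L) : 0 ≤ L := by
  refine le_of_mul_le_mul_right ?_ (pow_pos hG.pos 3)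
  simpa using (Nat.cast_nonneg _).trans (hG.card_commonNeighborFinset_le ∅ (by simp))

theorem card_interedges_le_card_mul (hG : IsPseudorandom G θ L) (A B : Finset V) :
    (#(G.interedges A B) : ℝ) ≤ #A * (L * θ ^ 2) :=
  calc (#(G.interedges A B) : ℝ) ≤ ∑ a ∈ A, (#(commonNeighborFinset G {a}) : ℝ) := by
        exact_mod_cast card_interedges_le_sum_card_commonNeighborFinset A B
    _ ≤ ∑ a ∈ A, L * θ ^ 2 := by
        gcongr with a
        simpa using hG.card_commonNeighborFinset_le {a} (by simp)
    _ = #A * (L * θ ^ 2) := by rw [sum_const, nsmul_eq_mul]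

theorem card_interedges_le_of_card_le (hG : IsPseudorandom G θ L) {A B : Finset V} {a b : ℝ}
    (hA : #A ≤ a) (hB : #B ≤ b) : (#(G.interedges A B) : ℝ) ≤ L * (a * b / θ + a + b) := by
  have hθ := hG.pos
  have ha : 0 ≤ a := (Nat.cast_nonneg _).trans hA
  refine (hG.card_interedges_le A B).trans (mul_le_mul_of_nonneg_left ?_ hG.nonneg)
  gcongr

theorem card_triangleTriples_le_card_interedges_mul (hG : IsPseudorandom G θ L)
    (A B C : Finset V) :
    (#(triangleTriples G A B C) : ℝ) ≤ #(G.interedges A B) * (L * θ) :=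
  calc (#(triangleTriples G A B C) : ℝ)
      ≤ ∑ x ∈ G.interedges A B, (#(commonNeighborFinset G {x.1, x.2}) : ℝ) := by
        exact_mod_cast card_triangleTriples_le_sum_card_commonNeighborFinset A B C
    _ ≤ ∑ _x ∈ G.interedges A B, L * θ := by
        refine sum_le_sum fun x hx ↦ ?_
        have card_eq : #{x.1, x.2} = 2 := card_pair (G.mem_interedges_iff.1 hx).2.2.ne
        simpa [card_eq] using hG.card_commonNeighborFinset_le {x.1, x.2} (by omega)
    _ = #(G.interedges A B) * (L * θ) := by rw [sum_const, nsmul_eq_mul]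

theorem card_triangleTriples_le_of_le_sq (hG : IsPseudorandom G θ L) {A B C : Finset V}
    {α β γ : ℝ} (hα : 1 ≤ α) (hαβ : α ≤ β) (hβγ : β ≤ γ) (hA : #A ≤ α ^ 2) (hB : #B ≤ β ^ 2)
    (hθα : θ ≤ α ^ 2) :
    (#(triangleTriples G A B C) : ℝ) ≤ 3 * L ^ 2 * (γ ^ 2 * (α * β)) := by
  have hθ := hG.pos
  have hL := hG.nonneg
  have hβ : 1 ≤ β := hα.trans hαβ
  have sq_mul_sq_le : α ^ 2 * β ^ 2 ≤ γ ^ 2 * (α * β) :=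
    calc α ^ 2 * β ^ 2 = (α * β) * (α * β) := by ring
      _ ≤ γ ^ 2 * (α * β) := by gcongr ?_ * _; nlinarith
  have mul_sq_le : θ * β ^ 2 ≤ γ ^ 2 * (α * β) := le_trans (by gcongr) sq_mul_sq_le
  have mul_sq_le' : θ * α ^ 2 ≤ γ ^ 2 * (α * β) := le_trans (by gcongr) mul_sq_le
  calc (#(triangleTriples G A B C) : ℝ)
      ≤ L * (α ^ 2 * β ^ 2 / θ + α ^ 2 + β ^ 2) * (L * θ) :=
        (hG.card_triangleTriples_le_card_interedges_mul A B C).trans <| by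
          gcongr
          exact hG.card_interedges_le_of_card_le hA hB
    _ = L ^ 2 * (α ^ 2 * β ^ 2 + θ * α ^ 2 + θ * β ^ 2) := by field_simp
    _ ≤ L ^ 2 * (γ ^ 2 * (α * β) + γ ^ 2 * (α * β) + γ ^ 2 * (α * β)) := by gcongr
    _ = 3 * L ^ 2 * (γ ^ 2 * (α * β)) := by ring

theorem card_triangleTriples_le_mul_card_interedges_add (hG : IsPseudorandom G θ L)
    {A : Finset V} (hA : #A ≤ θ) (B C : Finset V) :
    (#(triangleTriples G A B C) : ℝ) ≤ 2 * L * (#(G.interedges A C) + #(G.interedges B C)) := by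
  have hθ := hG.pos
  have hL := hG.nonneg
  have interedges_le (c : V) :
      (#(G.interedges {a ∈ A | G.Adj a c} {b ∈ B | G.Adj b c}) : ℝ) ≤
        2 * L * (#{a ∈ A | G.Adj a c} + #{b ∈ B | G.Adj b c}) := by
    have card_le : (#{a ∈ A | G.Adj a c} : ℝ) ≤ θ :=
      (Nat.cast_le.2 (card_filter_le _ _)).trans hA
    have mul_div_le : (#{a ∈ A | G.Adj a c} : ℝ) * #{b ∈ B | G.Adj b c} / θ ≤
        #{b ∈ B | G.Adj b c} := by
      rw [div_le_iff₀ hθ, mul_comm]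
      gcongr
    refine (hG.card_interedges_le _ _).trans ?_
    rw [mul_comm 2 L, mul_assoc]
    gcongr
    linarith [Nat.cast_nonneg (α := ℝ) #{a ∈ A | G.Adj a c}]
  calc (#(triangleTriples G A B C) : ℝ)
      ≤ ∑ c ∈ C, (#(G.interedges {a ∈ A | G.Adj a c} {b ∈ B | G.Adj b c}) : ℝ) := by
        exact_mod_cast card_triangleTriples_le_sum_card_interedges A B C
    _ ≤ ∑ c ∈ C, 2 * L * (#{a ∈ A | G.Adj a c} + #{b ∈ B | G.Adj b c}) :=
        sum_le_sum fun c _ ↦ interedges_le c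
    _ = 2 * L * (#(G.interedges A C) + #(G.interedges B C)) := by
        rw [← mul_sum, sum_add_distrib, card_interedges_eq_sum_card_filter,
          card_interedges_eq_sum_card_filter, Nat.cast_sum, Nat.cast_sum]

theorem card_triangleTriples_le_of_sq_le (hG : IsPseudorandom G θ L) {A B C : Finset V}
    {α β γ : ℝ} (hα : 1 ≤ α) (hαβ : α ≤ β) (hβγ : β ≤ γ) (hA : #A ≤ α ^ 2) (hB : #B ≤ β ^ 2)
    (hC : #C ≤ γ ^ 2) (hαθ : α ^ 2 ≤ θ) (hβθ : β ≤ α * θ) :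
    (#(triangleTriples G A B C) : ℝ) ≤ 12 * L ^ 2 * (γ ^ 2 * (α * β)) := by
  have hθ := hG.pos
  have hL := hG.nonneg
  have hβ : 1 ≤ β := hα.trans hαβ
  have sq_mul_sq_div_le : β ^ 2 * γ ^ 2 / θ ≤ γ ^ 2 * (α * β) := by
    rw [div_le_iff₀ hθ]
    calc β ^ 2 * γ ^ 2 = γ ^ 2 * β * β := by ring
      _ ≤ γ ^ 2 * β * (α * θ) := by gcongr
      _ = _ := by ring
  have sq_mul_sq_div_le' : α ^ 2 * γ ^ 2 / θ ≤ γ ^ 2 * (α * β) :=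
    le_trans (by gcongr) sq_mul_sq_div_le
  have sq_le : γ ^ 2 ≤ γ ^ 2 * (α * β) := le_mul_of_one_le_right (by positivity) (by nlinarith)
  have sq_le_sq : β ^ 2 ≤ γ ^ 2 := by gcongr
  have sq_le_sq' : α ^ 2 ≤ γ ^ 2 := le_trans (by gcongr) sq_le_sq
  calc (#(triangleTriples G A B C) : ℝ)
      ≤ 2 * L * (#(G.interedges A C) + #(G.interedges B C)) :=
        hG.card_triangleTriples_le_mul_card_interedges_add (hA.trans hαθ) B C
    _ ≤ 2 * L * (L * (α ^ 2 * γ ^ 2 / θ + α ^ 2 + γ ^ 2) +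
          L * (β ^ 2 * γ ^ 2 / θ + β ^ 2 + γ ^ 2)) := by
        gcongr
        exacts [hG.card_interedges_le_of_card_le hA hC, hG.card_interedges_le_of_card_le hB hC]
    _ = 2 * L ^ 2 * ((α ^ 2 * γ ^ 2 / θ + α ^ 2 + γ ^ 2) +
          (β ^ 2 * γ ^ 2 / θ + β ^ 2 + γ ^ 2)) := by ring
    _ ≤ 2 * L ^ 2 * (6 * (γ ^ 2 * (α * β))) := by gcongr; linarith
    _ = 12 * L ^ 2 * (γ ^ 2 * (α * β)) := by ring

theorem card_triangleTriples_le_of_mul_le (hG : IsPseudorandom G θ L) {A B C : Finset V}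
    {α β γ : ℝ} (hα : 1 ≤ α) (hβγ : β ≤ γ) (hA : #A ≤ α ^ 2) (hθβ : α * θ ≤ β) :
    (#(triangleTriples G A B C) : ℝ) ≤ L ^ 2 * (γ ^ 2 * (α * β)) := by
  have hθ := hG.pos
  have hL := hG.nonneg
  calc (#(triangleTriples G A B C) : ℝ) ≤ α ^ 2 * (L * θ ^ 2) * (L * θ) :=
        (hG.card_triangleTriples_le_card_interedges_mul A B C).trans <| by
          gcongr
          exact (hG.card_interedges_le_card_mul A B).trans (by gcongr)
    _ = L ^ 2 * (α ^ 2 * θ ^ 3) := by ring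
    _ ≤ L ^ 2 * (α ^ 4 * θ ^ 3) := by gcongr ?_ * (?_ * _); exact pow_le_pow_right₀ hα (by norm_num)
    _ = L ^ 2 * ((α * θ) ^ 2 * (α * (α * θ))) := by ring
    _ ≤ L ^ 2 * (γ ^ 2 * (α * β)) := by gcongr; exact hθβ.trans hβγ

theorem card_triangleTriples_le (hG : IsPseudorandom G θ L) {A B C : Finset V} {α β γ : ℝ}
    (hα : 1 ≤ α) (hαβ : α ≤ β) (hβγ : β ≤ γ) (hA : #A ≤ α ^ 2) (hB : #B ≤ β ^ 2)
    (hC : #C ≤ γ ^ 2) :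
    (#(triangleTriples G A B C) : ℝ) ≤ 12 * L ^ 2 * (γ ^ 2 * (α * β)) := by
  have hβ : 1 ≤ β := hα.trans hαβ
  have hP : 0 ≤ L ^ 2 * (γ ^ 2 * (α * β)) := by positivity
  rcases le_total θ (α ^ 2) with hθα | hαθ
  · linarith [hG.card_triangleTriples_le_of_le_sq (C := C) hα hαβ hβγ hA hB hθα]
  rcases le_total β (α * θ) with hβθ | hθβ
  · exact hG.card_triangleTriples_le_of_sq_le hα hαβ hβγ hA hB hC hαθ hβθ
  · linarith [hG.card_triangleTriples_le_of_mul_le (B := B) (C := C) hα hβγ hA hθβ]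

end IsPseudorandom

end Pseudorandom

section Dyadic

theorem exists_antitone_enumeration {V ι : Type*} [DecidableEq V] [LinearOrder ι] {k : ℕ}
    {s : Finset V} (hs : #s = k) (y : V → ι) :
    ∃ v : Fin k → V, v.Injective ∧ univ.image v = s ∧ Antitone (y ∘ v) := by
  let e : Fin k ≃ s := (s.equivFinOfCardEq hs).symm
  let σ := Tuple.sort (OrderDual.toDual ∘ y ∘ Subtype.val ∘ e)
  refine ⟨Subtype.val ∘ e ∘ σ, Subtype.val_injective.comp (e.injective.comp σ.injective), ?_,
    Tuple.monotone_sort (OrderDual.toDual ∘ y ∘ Subtype.val ∘ e)⟩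
  rw [← image_image, image_univ_of_surjective (e.surjective.comp σ.surjective), univ_eq_attach,
    attach_image_val]

theorem sum_le_sum_of_forall_exists_le {α β : Type*} {s : Finset α} {t : Finset β} {f : α → ℝ}
    {g : β → ℝ} (φ : β → α) (hg : ∀ b ∈ t, 0 ≤ g b)
    (hfg : ∀ a ∈ s, ∃ b ∈ t, φ b = a ∧ f a ≤ g b) : ∑ a ∈ s, f a ≤ ∑ b ∈ t, g b := by
  have fiber_nonneg (a : α) : ∀ b ∈ {b ∈ t | φ b = a}, 0 ≤ g b :=
    fun b hb ↦ hg b (mem_filter.1 hb).1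
  calc ∑ a ∈ s, f a ≤ ∑ a ∈ s, ∑ b ∈ t with φ b = a, g b := by
        refine sum_le_sum fun a ha ↦ ?_
        obtain ⟨b, hb, hba, hle⟩ := hfg a ha
        exact hle.trans (single_le_sum (fiber_nonneg a) (mem_filter.2 ⟨hb, hba⟩))
    _ ≤ ∑ b ∈ t, g b :=
        sum_fiberwise_le_sum_of_sum_fiber_nonneg fun a _ ↦ sum_nonneg (fiber_nonneg a)

theorem sum_cliqueFinset_four_prod_le {V : Type*} [Fintype V] [DecidableEq V]
    {G : SimpleGraph V} {y : V → ℝ} (hy : ∀ i, 0 ≤ y i) :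
    ∑ s ∈ G.cliqueFinset 4, ∏ i ∈ s, y i ≤
      ∑ x ∈ triangleTriples G univ univ univ with y x.2.2 ≤ y x.2.1 ∧ y x.2.1 ≤ y x.1,
        #(commonNeighborFinset G {x.1, x.2.1, x.2.2}) * (y x.1 * y x.2.1 * y x.2.2 ^ 2) := by
  simp_rw [← nsmul_eq_mul, ← sum_const]
  rw [sum_sigma']
  refine sum_le_sum_of_forall_exists_le (fun x ↦ {x.1.1, x.1.2.1, x.1.2.2, x.2})
    (fun x _ ↦ mul_nonneg (mul_nonneg (hy _) (hy _)) (sq_nonneg _)) fun s hs ↦ ?_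
  obtain ⟨hclique, hcard⟩ := SimpleGraph.mem_cliqueFinset_iff.1 hs
  obtain ⟨v, hv, rfl, hanti⟩ := exists_antitone_enumeration hcard y
  have adj {a b : Fin 4} (hab : a ≠ b) : G.Adj (v a) (v b) :=
    hclique (by simp) (by simp) (hv.ne hab)
  refine ⟨⟨(v 0, v 1, v 2), v 3⟩, ?_, ?_, ?_⟩
  · have h₀₁ : y (v 1) ≤ y (v 0) := hanti (by decide)
    have h₁₂ : y (v 2) ≤ y (v 1) := hanti (by decide)
    simp [mem_triangleTriples, mem_commonNeighborFinset, adj, h₀₁, h₁₂]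
  · ext a
    simp [Fin.exists_fin_succ, eq_comm]
  · rw [prod_image hv.injOn, Fin.prod_univ_four, pow_two, ← mul_assoc]
    exact mul_le_mul_of_nonneg_left (hanti (by decide : (2 : Fin 4) ≤ 3))
      (mul_nonneg (mul_nonneg (hy _) (hy _)) (hy _))

theorem exists_abs_le_inv_two_pow {a N : ℝ} (ha : |a| ≤ 1) (hN : 1 ≤ N) :
    ∃ t : ℕ, |a| ≤ (2 ^ t)⁻¹ ∧ (4 : ℝ) ^ t ≤ N ∧ ((2 ^ t)⁻¹ : ℝ) ^ 2 ≤ 4 * (a ^ 2 + N⁻¹) := by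
  set y := max |a| (√N)⁻¹ with y_def
  have sqrt_pos : 0 < √N := Real.sqrt_pos.2 (by linarith)
  have y_pos : 0 < y := lt_max_of_lt_right (inv_pos.2 sqrt_pos)
  have y_le_one : y ≤ 1 := max_le ha (inv_le_one_of_one_le₀ (Real.one_le_sqrt.2 hN))
  obtain ⟨t, ht, hlt⟩ := exists_nat_pow_near ((one_le_inv₀ y_pos).2 y_le_one) one_lt_two
  have y_sq_le : y ^ 2 ≤ a ^ 2 + N⁻¹ := by
    have inv_sqrt_sq : (√N)⁻¹ ^ 2 = N⁻¹ := by rw [inv_pow, Real.sq_sqrt (by linarith)]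
    rcases max_choice |a| (√N)⁻¹ with h | h <;> rw [y_def, h]
    · rw [sq_abs]
      exact le_add_of_nonneg_right (by positivity)
    · rw [inv_sqrt_sq]
      exact le_add_of_nonneg_left (sq_nonneg a)
  have inv_le : ((2 ^ t)⁻¹ : ℝ) ≤ 2 * y := by
    rw [inv_le_iff_one_le_mul₀ (by positivity)]
    rw [inv_lt_iff_one_lt_mul₀ y_pos, pow_succ] at hlt
    linarith
  refine ⟨t, (le_max_left _ _).trans ((le_inv_comm₀ y_pos (by positivity)).2 ht), ?_, ?_⟩
  · have le_sqrt : 2 ^ t ≤ √N := ht.trans ((inv_le_comm₀ y_pos sqrt_pos).2 (le_max_right _ _))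
    calc (4 : ℝ) ^ t = (2 ^ t) ^ 2 := by rw [← pow_mul, mul_comm, pow_mul]; norm_num
      _ ≤ N := (Real.le_sqrt (by positivity) (by positivity)).1 le_sqrt
  · calc ((2 ^ t)⁻¹ : ℝ) ^ 2 ≤ (2 * y) ^ 2 := by gcongr
      _ = 4 * y ^ 2 := by ring
      _ ≤ 4 * (a ^ 2 + N⁻¹) := by gcongr

theorem exists_dyadic_levels {V : Type*} [Fintype V] [Nonempty V] {x : V → ℝ}
    (hx : ∑ i, x i ^ 2 = 1) :
    ∃ t : V → ℕ, (∀ i, |x i| ≤ (2 ^ t i)⁻¹) ∧ (∀ i, 4 ^ t i ≤ Fintype.card V) ∧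
      ∀ k, (#{i | t i = k} : ℝ) ≤ (3 * 2 ^ k) ^ 2 := by
  have hV : (1 : ℝ) ≤ Fintype.card V := Nat.one_le_cast.2 Fintype.card_pos
  have abs_le_one (i : V) : |x i| ≤ 1 := by
    rw [← sq_le_one_iff_abs_le_one, ← hx]
    exact single_le_sum (f := fun i ↦ x i ^ 2) (fun j _ ↦ sq_nonneg _) (mem_univ i)
  choose t abs_le four_pow_le inv_sq_le using fun i ↦ exists_abs_le_inv_two_pow (abs_le_one i) hV
  refine ⟨t, abs_le, fun i ↦ by exact_mod_cast four_pow_le i, fun k ↦ ?_⟩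
  have card_mul_le : #{i | t i = k} * ((2 ^ k)⁻¹ : ℝ) ^ 2 ≤ 8 :=
    calc #{i | t i = k} * ((2 ^ k)⁻¹ : ℝ) ^ 2 = ∑ i with t i = k, ((2 ^ t i)⁻¹ : ℝ) ^ 2 := by
          rw [← nsmul_eq_mul, ← sum_const]
          exact sum_congr rfl fun i hi ↦ by rw [(mem_filter.1 hi).2]
      _ ≤ ∑ i, ((2 ^ t i)⁻¹ : ℝ) ^ 2 :=
          sum_le_sum_of_subset_of_nonneg (filter_subset _ _) fun i _ _ ↦ by positivity
      _ ≤ ∑ i, 4 * (x i ^ 2 + (Fintype.card V : ℝ)⁻¹) := sum_le_sum fun i _ ↦ inv_sq_le i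
      _ = 8 := by
          rw [← mul_sum, sum_add_distrib, hx, sum_const, card_univ, nsmul_eq_mul,
            mul_inv_cancel₀ (by positivity)]
          norm_num
  rw [inv_pow, ← div_eq_mul_inv, div_le_iff₀ (by positivity)] at card_mul_le
  linarith [mul_pow (3 : ℝ) (2 ^ k) 2, sq_nonneg ((2 : ℝ) ^ k)]

namespace IsPseudorandom

variable {V : Type*} [Fintype V] {G : SimpleGraph V} {θ L : ℝ}

theorem sum_triangleTriples_level_inv_two_pow_le (hG : IsPseudorandom G θ L) {t : V → ℕ}
    (hcard : ∀ k, (#{i | t i = k} : ℝ) ≤ (3 * 2 ^ k) ^ 2) {a b c : ℕ} (hab : a ≤ b)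
    (hbc : b ≤ c) :
    ∑ x ∈ triangleTriples G {i | t i = a} {i | t i = b} {i | t i = c},
      (2 ^ t x.1 * 2 ^ t x.2.1 * (2 ^ t x.2.2) ^ 2 : ℝ)⁻¹ ≤ 972 * L ^ 2 := by
  have card_le : (#(triangleTriples G {i | t i = a} {i | t i = b} {i | t i = c}) : ℝ) ≤
      12 * L ^ 2 * ((3 * 2 ^ c) ^ 2 * ((3 * 2 ^ a) * (3 * 2 ^ b))) := by
    refine hG.card_triangleTriples_le ?_ ?_ ?_ (hcard a) (hcard b) (hcard c)
    · linarith [one_le_pow₀ (one_le_two (α := ℝ)) (n := a)]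
    · gcongr; exact one_le_two
    · gcongr; exact one_le_two
  calc _ = ∑ x ∈ triangleTriples G {i | t i = a} {i | t i = b} {i | t i = c},
          (2 ^ a * 2 ^ b * (2 ^ c) ^ 2 : ℝ)⁻¹ := by
        refine sum_congr rfl fun x hx ↦ ?_
        obtain ⟨ha, hb, hc⟩ := (mem_triangleTriples.1 hx).1
        rw [(mem_filter.1 ha).2, (mem_filter.1 hb).2, (mem_filter.1 hc).2]
    _ ≤ 12 * L ^ 2 * ((3 * 2 ^ c) ^ 2 * ((3 * 2 ^ a) * (3 * 2 ^ b))) *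
          (2 ^ a * 2 ^ b * (2 ^ c) ^ 2 : ℝ)⁻¹ := by
        rw [sum_const, nsmul_eq_mul]
        gcongr
    _ = 972 * L ^ 2 := by field_simp; ring

theorem sum_triangleTriples_inv_two_pow_le (hG : IsPseudorandom G θ L) {t : V → ℕ} {m : ℕ}
    (ht : ∀ i, t i < m) (hcard : ∀ k, (#{i | t i = k} : ℝ) ≤ (3 * 2 ^ k) ^ 2) :
    ∑ x ∈ triangleTriples G univ univ univ with t x.2.1 ≤ t x.2.2 ∧ t x.1 ≤ t x.2.1,
      (2 ^ t x.1 * 2 ^ t x.2.1 * (2 ^ t x.2.2) ^ 2 : ℝ)⁻¹ ≤ 972 * L ^ 2 * m ^ 3 := by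
  let level (x : V × V × V) : ℕ × ℕ × ℕ := (t x.1, t x.2.1, t x.2.2)
  have level_mem : ∀ x ∈ {x ∈ triangleTriples G univ univ univ |
      t x.2.1 ≤ t x.2.2 ∧ t x.1 ≤ t x.2.1}, level x ∈ range m ×ˢ range m ×ˢ range m :=
    fun x _ ↦ by simp [level, ht]
  rw [← sum_fiberwise_of_maps_to level_mem]
  calc _ ≤ ∑ r ∈ range m ×ˢ range m ×ˢ range m, 972 * L ^ 2 := by
        refine sum_le_sum fun ⟨a, b, c⟩ _ ↦ ?_
        by_cases hsorted : b ≤ c ∧ a ≤ b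
        · refine (sum_le_sum_of_subset_of_nonneg ?_ fun _ _ _ ↦ by positivity).trans
            (hG.sum_triangleTriples_level_inv_two_pow_le hcard hsorted.2 hsorted.1)
          intro x
          simp only [level, mem_filter, mem_triangleTriples, mem_univ, Prod.mk.injEq]
          tauto
        · rw [sum_eq_zero]
          · positivity
          · intro x hx
            simp only [level, mem_filter, Prod.mk.injEq] at hx
            obtain ⟨⟨-, hx⟩, rfl, rfl, rfl⟩ := hx
            exact absurd hx hsorted
    _ = 972 * L ^ 2 * m ^ 3 := by
        simp only [sum_const, card_product, card_range, nsmul_eq_mul, Nat.cast_mul]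
        ring

theorem sum_cliqueFinset_four_prod_inv_two_pow_le [DecidableEq V] (hG : IsPseudorandom G θ L)
    {t : V → ℕ} {m : ℕ} (ht : ∀ i, t i < m)
    (hcard : ∀ k, (#{i | t i = k} : ℝ) ≤ (3 * 2 ^ k) ^ 2) :
    ∑ s ∈ G.cliqueFinset 4, ∏ i ∈ s, (2 ^ t i : ℝ)⁻¹ ≤ 972 * L ^ 3 * m ^ 3 := by
  refine (sum_cliqueFinset_four_prod_le fun i ↦ by positivity).trans ?_
  have inv_le_iff (i j : V) : (2 ^ t i : ℝ)⁻¹ ≤ (2 ^ t j)⁻¹ ↔ t j ≤ t i := by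
    rw [inv_le_inv₀ (by positivity) (by positivity), pow_le_pow_iff_right₀ one_lt_two]
  simp_rw [inv_le_iff]
  calc _ ≤ ∑ x ∈ triangleTriples G univ univ univ with t x.2.1 ≤ t x.2.2 ∧ t x.1 ≤ t x.2.1,
          L * (2 ^ t x.1 * 2 ^ t x.2.1 * (2 ^ t x.2.2) ^ 2 : ℝ)⁻¹ := by
        refine sum_le_sum fun x hx ↦ ?_
        obtain ⟨-, hAB, hAC, hBC⟩ := mem_triangleTriples.1 (mem_filter.1 hx).1
        have card_eq : #{x.1, x.2.1, x.2.2} = 3 :=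
          card_eq_three.2 ⟨_, _, _, hAB.ne, hAC.ne, hBC.ne, rfl⟩
        rw [inv_pow, ← mul_inv, ← mul_inv]
        gcongr
        simpa [card_eq] using hG.card_commonNeighborFinset_le _ card_eq.le
    _ ≤ L * (972 * L ^ 2 * m ^ 3) := by
        rw [← mul_sum]
        exact mul_le_mul_of_nonneg_left (hG.sum_triangleTriples_inv_two_pow_le ht hcard) hG.nonneg
    _ = 972 * L ^ 3 * m ^ 3 := by ring

theorem abs_sum_cliqueFinset_four_prod_le [DecidableEq V] [Nonempty V]
    (hG : IsPseudorandom G θ L) {m : ℕ} (hm : Fintype.card V < 4 ^ m) {x : V → ℝ}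
    (hx : ∑ i, x i ^ 2 = 1) :
    |∑ s ∈ G.cliqueFinset 4, ∏ i ∈ s, x i| ≤ 972 * L ^ 3 * m ^ 3 := by
  obtain ⟨t, abs_le, four_pow_le, hcard⟩ := exists_dyadic_levels hx
  have lt_m (i : V) : t i < m :=
    (Nat.pow_lt_pow_iff_right (by norm_num)).1 ((four_pow_le i).trans_lt hm)
  calc |∑ s ∈ G.cliqueFinset 4, ∏ i ∈ s, x i| ≤ ∑ s ∈ G.cliqueFinset 4, ∏ i ∈ s, |x i| := by
        simp_rw [← abs_prod]
        exact abs_sum_le_sum_abs _ _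
    _ ≤ ∑ s ∈ G.cliqueFinset 4, ∏ i ∈ s, (2 ^ t i : ℝ)⁻¹ := by
        gcongr with _ _ i
        exact abs_le i
    _ ≤ 972 * L ^ 3 * m ^ 3 := hG.sum_cliqueFinset_four_prod_inv_two_pow_le lt_m hcard

end IsPseudorandom

end Dyadic

section MatrixRep

theorem sum_sq_col_le_sq_norm_toEuclideanCLM {ι : Type*} [Fintype ι] [DecidableEq ι]
    (M : Matrix ι ι ℝ) (j : ι) : ∑ i, M i j ^ 2 ≤ ‖Matrix.toEuclideanCLM (𝕜 := ℝ) M‖ ^ 2 := by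
  have apply_single (i : ι) :
      Matrix.toEuclideanCLM (𝕜 := ℝ) M (EuclideanSpace.single j 1) i = M i j := by
    simp [Matrix.ofLp_toEuclideanCLM]
  calc ∑ i, M i j ^ 2 = ‖Matrix.toEuclideanCLM (𝕜 := ℝ) M (EuclideanSpace.single j 1)‖ ^ 2 := by
        simp [EuclideanSpace.norm_sq_eq, apply_single]
    _ ≤ ‖Matrix.toEuclideanCLM (𝕜 := ℝ) M‖ ^ 2 := by
        gcongr
        exact ContinuousLinearMap.unit_le_opNorm _ _ (by simp)

theorem sq_sum_entries_le {ι : Type*} [Fintype ι] [DecidableEq ι] (M : Matrix ι ι ℝ)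
    (P : Finset (ι × ι)) :
    (∑ x ∈ P, M x.1 x.2) ^ 2 ≤
      #P * (#(P.image Prod.snd) * ‖Matrix.toEuclideanCLM (𝕜 := ℝ) M‖ ^ 2) := by
  refine sq_sum_le_card_mul_sum_sq.trans ?_
  gcongr
  calc ∑ x ∈ P, M x.1 x.2 ^ 2 ≤ ∑ x ∈ univ ×ˢ P.image Prod.snd, M x.1 x.2 ^ 2 :=
        sum_le_sum_of_subset_of_nonneg
          (fun x hx ↦ mem_product.2 ⟨mem_univ _, mem_image_of_mem _ hx⟩) fun _ _ _ ↦ sq_nonneg _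
    _ = ∑ j ∈ P.image Prod.snd, ∑ i, M i j ^ 2 := sum_product_right _ _ _
    _ ≤ #(P.image Prod.snd) * ‖Matrix.toEuclideanCLM (𝕜 := ℝ) M‖ ^ 2 := by
        rw [← nsmul_eq_mul]
        exact sum_le_card_nsmul _ _ _ fun j _ ↦ sum_sq_col_le_sq_norm_toEuclideanCLM M j

/-- The exponent of the monomial `∏ l, x (I l)`, the entry of `x^{⊗k}` at the tuple `I`. -/
noncomputable def tupleExponent {σ : Type*} {k : ℕ} (I : Fin k → σ) : σ →₀ ℕ :=
  ∑ l, Finsupp.single (I l) 1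

theorem tupleExponent_apply {σ : Type*} [DecidableEq σ] {k : ℕ} (I : Fin k → σ) (v : σ) :
    tupleExponent I v = #{l | I l = v} := by
  classical
  simp [tupleExponent, Finsupp.finsetSum_apply, Finsupp.single_apply]

theorem exists_tupleExponent_eq {σ : Type*} (α : σ →₀ ℕ) :
    ∃ I : Fin α.degree → σ, tupleExponent I = α := by
  induction h : α.degree generalizing α with
  | zero =>
    rw [(Finsupp.degree_eq_zero_iff α).1 h]
    exact ⟨Fin.elim0, by simp [tupleExponent]⟩
  | succ k ih =>
    have ne_zero : α ≠ 0 := by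
      rintro rfl
      simp at h
    obtain ⟨i, hi⟩ := Finsupp.ne_iff.1 ne_zero
    obtain ⟨β, rfl⟩ := exists_add_of_le (Finsupp.single_le_iff.2 (Nat.one_le_iff_ne_zero.2 hi))
    obtain ⟨I, rfl⟩ := ih β (by simpa [add_comm 1] using h)
    exact ⟨Fin.cons i I, by simp [tupleExponent, Fin.sum_univ_succ]⟩

variable {n : ℕ}

theorem eval_monomial_tupleExponent {k : ℕ} (x : Fin n → ℝ) (I J : Fin k → Fin n) (c : ℝ) :
    MvPolynomial.eval x (MvPolynomial.monomial (tupleExponent I + tupleExponent J) c) =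
      tensorPower k x I * (c * tensorPower k x J) := by
  have monomial_eq (I : Fin k → Fin n) :
      MvPolynomial.monomial (tupleExponent I) (1 : ℝ) = ∏ l, MvPolynomial.X (I l) :=
    MvPolynomial.monomial_sum_one _ _
  have monomial_add : MvPolynomial.monomial (tupleExponent I + tupleExponent J) c =
      MvPolynomial.C c * (MvPolynomial.monomial (tupleExponent I) 1 *
        MvPolynomial.monomial (tupleExponent J) 1) := by
    simp [MvPolynomial.monomial_mul, MvPolynomial.C_mul_monomial]
  rw [monomial_add, monomial_eq, monomial_eq]
  simp only [map_mul, MvPolynomial.eval_C, map_prod, MvPolynomial.eval_X, tensorPower]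
  ring

theorem dotProduct_mulVec_tensorPower {k : ℕ}
    (M : Matrix (Fin k → Fin n) (Fin k → Fin n) ℝ) (x : Fin n → ℝ) :
    tensorPower k x ⬝ᵥ M.mulVec (tensorPower k x) = MvPolynomial.eval x
      (∑ I, ∑ J, MvPolynomial.monomial (tupleExponent I + tupleExponent J) (M I J)) := by
  simp only [map_sum, eval_monomial_tupleExponent, dotProduct, Matrix.mulVec, mul_sum]

theorem IsMatrixRep.add {d : ℕ} {h₁ h₂ : MvPolynomial (Fin n) ℝ}
    {M₁ M₂ : Matrix (Fin (d / 2) → Fin n) (Fin (d / 2) → Fin n) ℝ}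
    (hM₁ : IsMatrixRep d h₁ M₁) (hM₂ : IsMatrixRep d h₂ M₂) :
    IsMatrixRep d (h₁ + h₂) (M₁ + M₂) :=
  ⟨hM₁.1.add hM₂.1, fun x ↦ by
    rw [Matrix.add_mulVec, dotProduct_add, hM₁.2, hM₂.2, map_add]⟩

theorem exists_isMatrixRep_monomial (k : ℕ) {α : Fin n →₀ ℕ} (hα : α.degree = k + k) (c : ℝ) :
    ∃ M : Matrix (Fin k → Fin n) (Fin k → Fin n) ℝ, M.IsSymm ∧ ∀ x,
      tensorPower k x ⬝ᵥ M.mulVec (tensorPower k x) =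
        MvPolynomial.eval x (MvPolynomial.monomial α c) := by
  obtain ⟨τ, hτ⟩ : ∃ τ : Fin (k + k) → Fin n, tupleExponent τ = α :=
    hα ▸ exists_tupleExponent_eq α
  let I : Fin k → Fin n := fun l ↦ τ (Fin.castAdd k l)
  let J : Fin k → Fin n := fun l ↦ τ (Fin.natAdd k l)
  have hIJ : α = tupleExponent I + tupleExponent J := by
    rw [← hτ, tupleExponent, Fin.sum_univ_add]
    rfl
  refine ⟨Matrix.single I J (c / 2) + Matrix.single J I (c / 2), ?_, fun x ↦ ?_⟩
  · rw [Matrix.IsSymm, Matrix.transpose_add, Matrix.transpose_single, Matrix.transpose_single,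
      add_comm]
  · rw [hIJ, eval_monomial_tupleExponent, Matrix.add_mulVec, dotProduct_add,
      Matrix.single_mulVec, Matrix.single_mulVec]
    simp only [dotProduct, Function.update_apply, Pi.zero_apply, mul_ite, mul_zero,
      sum_ite_eq', mem_univ, if_true]
    ring

theorem exists_isMatrixRep {d : ℕ} (hd : Even d) {h : MvPolynomial (Fin n) ℝ}
    (hh : h.IsHomogeneous d) : ∃ M, IsMatrixRep d h M := by
  rw [h.as_sum]
  refine sum_induction _ (fun g ↦ ∃ M, IsMatrixRep d g M) ?_ ?_ fun α hα ↦ ?_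
  · rintro g₁ g₂ ⟨M₁, hM₁⟩ ⟨M₂, hM₂⟩
    exact ⟨M₁ + M₂, hM₁.add hM₂⟩
  · exact ⟨0, Matrix.isSymm_zero, fun x ↦ by simp⟩
  · have degree_eq : α.degree = d / 2 + d / 2 := by
      rw [← mul_two, Nat.div_mul_cancel hd.two_dvd, Finsupp.degree_eq_weight_one]
      exact hh (MvPolynomial.mem_support_iff.1 hα)
    exact exists_isMatrixRep_monomial (d / 2) degree_eq (h.coeff α)

theorem le_spNorm {d : ℕ} (hd : Even d) {h : MvPolynomial (Fin n) ℝ} (hh : h.IsHomogeneous d)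
    {r : ℝ} (hr : ∀ M, IsMatrixRep d h M → r ≤ ‖Matrix.toEuclideanCLM (𝕜 := ℝ) M‖) :
    r ≤ spNorm d h := by
  obtain ⟨M, hM⟩ := exists_isMatrixRep hd hh
  refine le_csInf ⟨_, M, hM, rfl⟩ ?_
  rintro _ ⟨M, hM, rfl⟩
  exact hr M hM

/-- The positions `(I, J)` of a matrix representation that contribute to the monomials occurring
in `h`. -/
noncomputable def repSupport (k : ℕ) (h : MvPolynomial (Fin n) ℝ) :
    Finset ((Fin k → Fin n) × (Fin k → Fin n)) :=
  {x | tupleExponent x.1 + tupleExponent x.2 ∈ h.support}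

theorem mem_repSupport {k : ℕ} {h : MvPolynomial (Fin n) ℝ}
    {x : (Fin k → Fin n) × (Fin k → Fin n)} :
    x ∈ repSupport k h ↔ tupleExponent x.1 + tupleExponent x.2 ∈ h.support := by
  simp [repSupport]

theorem IsMatrixRep.coeff_eq {d : ℕ} {h : MvPolynomial (Fin n) ℝ}
    {M : Matrix (Fin (d / 2) → Fin n) (Fin (d / 2) → Fin n) ℝ} (hM : IsMatrixRep d h M)
    (α : Fin n →₀ ℕ) :
    h.coeff α = ∑ x : (Fin (d / 2) → Fin n) × (Fin (d / 2) → Fin n),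
      if tupleExponent x.1 + tupleExponent x.2 = α then M x.1 x.2 else 0 := by
  have eq_sum : h = ∑ I, ∑ J, MvPolynomial.monomial (tupleExponent I + tupleExponent J) (M I J) :=
    MvPolynomial.funext fun x ↦ by rw [← hM.2 x, dotProduct_mulVec_tensorPower]
  conv_lhs => rw [eq_sum]
  simp only [MvPolynomial.coeff_sum, MvPolynomial.coeff_monomial, Fintype.sum_prod_type]

theorem IsMatrixRep.sum_repSupport {d : ℕ} {h : MvPolynomial (Fin n) ℝ}
    {M : Matrix (Fin (d / 2) → Fin n) (Fin (d / 2) → Fin n) ℝ} (hM : IsMatrixRep d h M) :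
    ∑ x ∈ repSupport (d / 2) h, M x.1 x.2 = MvPolynomial.eval (fun _ ↦ 1) h := by
  have eval_one : MvPolynomial.eval (fun _ ↦ 1) h = ∑ α ∈ h.support, h.coeff α := by
    simp [MvPolynomial.eval_eq]
  simp_rw [eval_one, hM.coeff_eq]
  rw [sum_comm, repSupport, sum_filter]
  exact sum_congr rfl fun x _ ↦ by rw [sum_ite_eq]

theorem IsMatrixRep.sq_eval_one_le {d : ℕ} {h : MvPolynomial (Fin n) ℝ}
    {M : Matrix (Fin (d / 2) → Fin n) (Fin (d / 2) → Fin n) ℝ} (hM : IsMatrixRep d h M) :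
    MvPolynomial.eval (fun _ ↦ 1) h ^ 2 ≤ #(repSupport (d / 2) h) *
      (#((repSupport (d / 2) h).image Prod.snd) * ‖Matrix.toEuclideanCLM (𝕜 := ℝ) M‖ ^ 2) :=
  hM.sum_repSupport ▸ sq_sum_entries_le M _

end MatrixRep

section CliquePower

theorem card_filter_sum_card_eq_le {V : Type*} (𝒞 : Finset (Finset V)) (m κ : ℕ)
    {z : ℝ} (hz : 0 < z) :
    #{u ∈ Fintype.piFinset fun _ : Fin m ↦ 𝒞 | ∑ k, #(u k) = κ} ≤
      z ^ κ * (∑ u ∈ 𝒞, (z ^ #u)⁻¹) ^ m := by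
  rw [card_eq_sum_ones, Nat.cast_sum, sum_pow', mul_sum, sum_filter]
  refine sum_le_sum fun u _ ↦ ?_
  rw [prod_inv_distrib, prod_pow_eq_pow_sum]
  split_ifs with h
  · rw [h, mul_inv_cancel₀ (by positivity), Nat.cast_one]
  · positivity

theorem exists_subset_card_filter_mem_eq {ι V : Type*} [Fintype ι] [Finite V] [DecidableEq V]
    (c : ι → Finset V) {β : V → ℕ} (hβ : ∀ v, β v ≤ #{k | v ∈ c k}) :
    ∃ u : ι → Finset V, (∀ k, u k ⊆ c k) ∧ ∀ v, #{k | v ∈ u k} = β v := by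
  cases nonempty_fintype V
  choose K subset_K card_K using fun v ↦ exists_subset_card_eq (hβ v)
  refine ⟨fun k ↦ {v | k ∈ K v}, fun k v hv ↦ ?_, fun v ↦ ?_⟩
  · exact (mem_filter.1 (subset_K v (mem_filter.1 hv).2)).2
  · simp [card_K]

theorem sum_card_eq_sum_card_filter_mem {ι V : Type*} [Fintype ι] [Fintype V] [DecidableEq V]
    (u : ι → Finset V) : ∑ k, #(u k) = ∑ v, #{k | v ∈ u k} := by
  simpa [bipartiteAbove, bipartiteBelow] using
    sum_card_bipartiteAbove_eq_sum_card_bipartiteBelow (s := univ) (t := univ)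
      (fun (k : ι) (v : V) ↦ v ∈ u k)

theorem degree_tupleExponent {σ : Type*} {k : ℕ} (I : Fin k → σ) :
    (tupleExponent I).degree = k := by
  simp [tupleExponent]

theorem tupleExponent_apply_self_pos {σ : Type*} {k : ℕ} (I : Fin k → σ) (l : Fin k) :
    0 < tupleExponent I (I l) := by
  rw [tupleExponent_apply, card_pos]
  exact ⟨l, by simp⟩

variable {n : ℕ} {G : SimpleGraph (Fin n)}

theorem eval_cliquePoly (x : Fin n → ℝ) :
    MvPolynomial.eval x (cliquePoly G) = ∑ s ∈ G.cliqueFinset 4, ∏ i ∈ s, x i := by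
  simp [cliquePoly]

theorem eval_one_cliquePoly :
    MvPolynomial.eval (fun _ ↦ 1) (cliquePoly G) = #(G.cliqueFinset 4) := by
  simp [eval_cliquePoly]

theorem cliquePoly_isHomogeneous : (cliquePoly G).IsHomogeneous 4 := by
  refine MvPolynomial.IsHomogeneous.sum _ _ _ fun s hs ↦ ?_
  have prod_isHomogeneous := MvPolynomial.IsHomogeneous.prod s
    (fun i ↦ (MvPolynomial.X i : MvPolynomial (Fin n) ℝ)) (fun _ ↦ 1)
    fun i _ ↦ MvPolynomial.isHomogeneous_X _ _
  rwa [sum_const, smul_eq_mul, mul_one,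
    (SimpleGraph.mem_cliqueFinset_iff.1 hs).card_eq] at prod_isHomogeneous

theorem exists_cliques_of_mem_support {m : ℕ} {α : Fin n →₀ ℕ}
    (hα : α ∈ (cliquePoly G ^ m).support) :
    ∃ c : Fin m → Finset (Fin n), (∀ k, c k ∈ G.cliqueFinset 4) ∧
      ∀ v, α v = #{k | v ∈ c k} := by
  have pow_eq : cliquePoly G ^ m = ∑ c ∈ Fintype.piFinset fun _ : Fin m ↦ G.cliqueFinset 4,
      MvPolynomial.monomial (∑ k, ∑ i ∈ c k, Finsupp.single i 1) (1 : ℝ) := by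
    simp only [cliquePoly, sum_pow', MvPolynomial.monomial_sum_one]
    rfl
  rw [pow_eq] at hα
  obtain ⟨c, hc, hαc⟩ := mem_biUnion.1 (MvPolynomial.support_sum hα)
  refine ⟨c, Fintype.mem_piFinset.1 hc, fun v ↦ ?_⟩
  rw [mem_singleton.1 (MvPolynomial.support_monomial_subset hαc)]
  simp [Finsupp.finsetSum_apply, Finsupp.single_apply]

theorem card_repSupport_cliquePoly_pow_le (m κ : ℕ) :
    #(repSupport κ (cliquePoly G ^ m)) ≤ #(G.cliqueFinset 4) ^ m * (4 * m) ^ (κ + κ) := by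
  let U (c : Fin m → Finset (Fin n)) : Finset (Fin n) := univ.biUnion c
  have subset : repSupport κ (cliquePoly G ^ m) ⊆
      (Fintype.piFinset fun _ : Fin m ↦ G.cliqueFinset 4).biUnion fun c ↦
        (Fintype.piFinset fun _ ↦ U c) ×ˢ (Fintype.piFinset fun _ ↦ U c) := by
    rintro ⟨I, J⟩ hIJ
    obtain ⟨c, hc, hα⟩ := exists_cliques_of_mem_support (mem_repSupport.1 hIJ)
    have mem_U {v : Fin n} (hv : 0 < (tupleExponent I + tupleExponent J) v) : v ∈ U c := by
      rw [hα v, card_pos] at hv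
      obtain ⟨k, hk⟩ := hv
      exact mem_biUnion.2 ⟨k, mem_univ _, (mem_filter.1 hk).2⟩
    refine mem_biUnion.2 ⟨c, Fintype.mem_piFinset.2 hc, mem_product.2
      ⟨Fintype.mem_piFinset.2 fun l ↦ mem_U ?_, Fintype.mem_piFinset.2 fun l ↦ mem_U ?_⟩⟩
    · exact Nat.add_pos_left (tupleExponent_apply_self_pos I l) _
    · exact Nat.add_pos_right _ (tupleExponent_apply_self_pos J l)
  refine (card_le_card subset).trans ?_
  rw [← Fintype.card_piFinset_const]
  refine card_biUnion_le_card_mul _ _ _ fun c hc ↦ ?_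
  have card_U_le : #(U c) ≤ 4 * m := by
    simpa [mul_comm] using card_biUnion_le_card_mul univ c 4 fun k _ ↦
      (SimpleGraph.mem_cliqueFinset_iff.1 (Fintype.mem_piFinset.1 hc k)).card_eq.le
  rw [card_product, Fintype.card_piFinset_const, ← pow_add]
  gcongr

/-- The cliques of `G` with at most four vertices. -/
noncomputable def smallCliques {V : Type*} [Fintype V] [DecidableEq V] (G : SimpleGraph V) :
    Finset (Finset V) :=
  (range 5).biUnion fun j ↦ G.cliqueFinset j

theorem mem_smallCliques_of_subset {V : Type*} [Fintype V] [DecidableEq V] {G : SimpleGraph V}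
    {s t : Finset V} (ht : t ∈ G.cliqueFinset 4) (hst : s ⊆ t) : s ∈ smallCliques G := by
  obtain ⟨isClique, card_eq⟩ := SimpleGraph.mem_cliqueFinset_iff.1 ht
  refine mem_biUnion.2 ⟨#s, mem_range.2 ?_,
    SimpleGraph.mem_cliqueFinset_iff.2 ⟨isClique.subset (mod_cast hst), rfl⟩⟩
  exact Nat.lt_succ_of_le (card_eq ▸ card_le_card hst)

theorem card_image_snd_repSupport_cliquePoly_pow_le (m κ : ℕ) :
    #((repSupport κ (cliquePoly G ^ m)).image Prod.snd) ≤
      #{u ∈ Fintype.piFinset fun _ : Fin m ↦ smallCliques G | ∑ k, #(u k) = κ} * κ ^ κ := by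
  refine (card_le_card
    (t := Finset.biUnion _ fun u ↦ Fintype.piFinset fun _ ↦ univ.biUnion u) ?_).trans
    (card_biUnion_le_card_mul _ _ _ fun u hu ↦ ?_)
  · intro J hJ
    obtain ⟨⟨I, J⟩, hIJ, rfl⟩ := mem_image.1 hJ
    obtain ⟨c, hc, hα⟩ := exists_cliques_of_mem_support (mem_repSupport.1 hIJ)
    obtain ⟨u, u_subset, card_u⟩ := exists_subset_card_filter_mem_eq c (β := tupleExponent J)
      fun v ↦ (Nat.le_add_left _ _).trans_eq (hα v)
    refine mem_biUnion.2 ⟨u, mem_filter.2 ⟨Fintype.mem_piFinset.2 fun k ↦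
      mem_smallCliques_of_subset (hc k) (u_subset k), ?_⟩, Fintype.mem_piFinset.2 fun l ↦ ?_⟩
    · rw [sum_card_eq_sum_card_filter_mem, sum_congr rfl fun v _ ↦ card_u v,
        ← Finsupp.degree_eq_sum, degree_tupleExponent]
    · obtain ⟨k, hk⟩ := card_pos.1 ((tupleExponent_apply_self_pos J l).trans_eq (card_u _).symm)
      exact mem_biUnion.2 ⟨k, mem_univ _, (mem_filter.1 hk).2⟩
  · rw [Fintype.card_piFinset_const]
    exact Nat.pow_le_pow_left (card_biUnion_le.trans (mem_filter.1 hu).2.le) _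

theorem IsMatrixRep.card_cliqueFinset_four_pow_le {m : ℕ}
    {M : Matrix (Fin (4 * m / 2) → Fin n) (Fin (4 * m / 2) → Fin n) ℝ}
    (hM : IsMatrixRep (4 * m) (cliquePoly G ^ m) M) {z : ℝ} (hz : 0 < z) :
    (#(G.cliqueFinset 4) : ℝ) ^ m ≤ ((4 * m) ^ 6 * z ^ 2 * ∑ u ∈ smallCliques G, (z ^ #u)⁻¹) ^ m *
      ‖Matrix.toEuclideanCLM (𝕜 := ℝ) M‖ ^ 2 := by
  have half_eq : 4 * m / 2 = 2 * m := by omega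
  have entries_le : (#(repSupport (4 * m / 2) (cliquePoly G ^ m)) : ℝ) ≤
      #(G.cliqueFinset 4) ^ m * ((4 * m) ^ 4) ^ m := by
    have h := card_repSupport_cliquePoly_pow_le (G := G) m (4 * m / 2)
    rw [half_eq, ← two_mul, ← mul_assoc, pow_mul] at h
    exact_mod_cast half_eq ▸ h
  have columns_le :
      (#((repSupport (4 * m / 2) (cliquePoly G ^ m)).image Prod.snd) : ℝ) ≤
        (z ^ 2) ^ m * (∑ u ∈ smallCliques G, (z ^ #u)⁻¹) ^ m * ((4 * m) ^ 2) ^ m :=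
    calc _ ≤ _ := Nat.cast_le.2 (card_image_snd_repSupport_cliquePoly_pow_le m _)
      _ ≤ (z ^ 2) ^ m * (∑ u ∈ smallCliques G, (z ^ #u)⁻¹) ^ m * ((2 * m) ^ 2) ^ m := by
          rw [Nat.cast_mul, half_eq, ← pow_mul, ← pow_mul]
          push_cast
          gcongr
          exact card_filter_sum_card_eq_le _ m _ hz
      _ ≤ _ := by
          gcongr
          norm_num
  have factor_pow (a S : ℝ) : (a ^ 6 * z ^ 2 * S) ^ m =
      (a ^ 4) ^ m * ((z ^ 2) ^ m * S ^ m * (a ^ 2) ^ m) := by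
    simp only [← mul_pow]
    ring
  obtain pow_eq | pow_pos := (show 0 ≤ (#(G.cliqueFinset 4) : ℝ) ^ m by positivity).eq_or_lt
  · exact pow_eq ▸ by positivity
  refine le_of_mul_le_mul_left ?_ pow_pos
  calc (#(G.cliqueFinset 4) : ℝ) ^ m * #(G.cliqueFinset 4) ^ m
      = MvPolynomial.eval (fun _ ↦ 1) (cliquePoly G ^ m) ^ 2 := by
        rw [map_pow, eval_one_cliquePoly, sq]
    _ ≤ _ := hM.sq_eval_one_le
    _ ≤ #(G.cliqueFinset 4) ^ m * ((4 * m) ^ 4) ^ m * ((z ^ 2) ^ m *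
        (∑ u ∈ smallCliques G, (z ^ #u)⁻¹) ^ m * ((4 * m) ^ 2) ^ m *
          ‖Matrix.toEuclideanCLM (𝕜 := ℝ) M‖ ^ 2) := by
        gcongr
    _ = _ := by
        rw [factor_pow]
        ring

end CliquePower

section SmallCliques

variable {V : Type*} [Fintype V] [DecidableEq V] {G : SimpleGraph V}

theorem card_cliqueFinset_succ_le (j : ℕ) :
    #(G.cliqueFinset (j + 1)) ≤ ∑ s ∈ G.cliqueFinset j, #(commonNeighborFinset G s) := by
  rw [← card_sigma]
  refine le_trans (card_le_card (t := ((G.cliqueFinset j).sigma fun s ↦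
    commonNeighborFinset G s).image fun y ↦ insert y.2 y.1) fun t ht ↦ ?_) card_image_le
  obtain ⟨isClique, card_eq⟩ := SimpleGraph.mem_cliqueFinset_iff.1 ht
  obtain ⟨v, hv⟩ : t.Nonempty := card_pos.1 (by omega)
  refine mem_image.2 ⟨⟨t.erase v, v⟩, mem_sigma.2 ⟨?_, ?_⟩, insert_erase hv⟩
  · refine SimpleGraph.mem_cliqueFinset_iff.2 ⟨isClique.subset (mod_cast erase_subset v t), ?_⟩
    rw [card_erase_of_mem hv, card_eq, Nat.add_sub_cancel]
  · exact mem_commonNeighborFinset.2 fun w hw ↦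
      isClique (mem_of_mem_erase hw) hv (ne_of_mem_erase hw)

variable {ρ L : ℝ}

theorem IsPseudorandom.card_cliqueFinset_le (hG : IsPseudorandom G (ρ ^ 2) L) {j : ℕ}
    (hj : j ≤ 4) : #(G.cliqueFinset j) ≤ L ^ j * ρ ^ (j * (7 - j)) := by
  induction j with
  | zero =>
    have : G.cliqueFinset 0 = {∅} := by
      ext s
      simp
    simp [this]
  | succ j ih =>
    have hL : 0 ≤ L := hG.nonneg
    have hj' : j ≤ 3 := Nat.le_of_succ_le_succ hj
    calc (#(G.cliqueFinset (j + 1)) : ℝ)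
        ≤ ∑ s ∈ G.cliqueFinset j, (#(commonNeighborFinset G s) : ℝ) :=
          mod_cast card_cliqueFinset_succ_le j
      _ ≤ #(G.cliqueFinset j) * (L * (ρ ^ 2) ^ (3 - j)) := by
          rw [← nsmul_eq_mul]
          refine sum_le_card_nsmul _ _ _ fun s hs ↦ ?_
          rw [← (SimpleGraph.mem_cliqueFinset_iff.1 hs).card_eq]
          refine hG.card_commonNeighborFinset_le s ?_
          rw [(SimpleGraph.mem_cliqueFinset_iff.1 hs).card_eq]
          omega
      _ ≤ L ^ j * ρ ^ (j * (7 - j)) * (L * (ρ ^ 2) ^ (3 - j)) := by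
          gcongr
          exact ih (by omega)
      _ = L ^ (j + 1) * ρ ^ (j * (7 - j) + 2 * (3 - j)) := by ring
      _ = L ^ (j + 1) * ρ ^ ((j + 1) * (7 - (j + 1))) := by
          congr 2
          interval_cases j <;> rfl

theorem IsPseudorandom.sum_smallCliques_le (hG : IsPseudorandom G (ρ ^ 2) L) (hρ : 1 ≤ ρ)
    (hL : 1 ≤ L) : ∑ u ∈ smallCliques G, ((ρ ^ 3) ^ #u)⁻¹ ≤ 5 * (L ^ 4 * ρ ^ 4) := by
  have disjoint : (range 5 : Set ℕ).PairwiseDisjoint fun j ↦ G.cliqueFinset j :=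
    fun i _ j _ hij ↦ disjoint_left.2 fun u hi hj ↦ hij <| by
      rw [← (SimpleGraph.mem_cliqueFinset_iff.1 hi).card_eq,
        (SimpleGraph.mem_cliqueFinset_iff.1 hj).card_eq]
  have card_le {j : ℕ} (hj : j ≤ 4) :
      #(G.cliqueFinset j) ≤ L ^ 4 * ρ ^ 4 * (ρ ^ 3) ^ j :=
    calc (#(G.cliqueFinset j) : ℝ) ≤ L ^ j * ρ ^ (j * (7 - j)) := hG.card_cliqueFinset_le hj
      _ ≤ L ^ 4 * ρ ^ (4 + 3 * j) := by
          gcongr ?_ * ?_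
          · exact pow_le_pow_right₀ hL hj
          · exact pow_le_pow_right₀ hρ (by interval_cases j <;> norm_num)
      _ = L ^ 4 * ρ ^ 4 * (ρ ^ 3) ^ j := by ring
  calc ∑ u ∈ smallCliques G, ((ρ ^ 3) ^ #u)⁻¹
      = ∑ j ∈ range 5, ∑ u ∈ G.cliqueFinset j, ((ρ ^ 3) ^ #u)⁻¹ := sum_biUnion disjoint
    _ = ∑ j ∈ range 5, #(G.cliqueFinset j) / (ρ ^ 3) ^ j := by
        refine sum_congr rfl fun j _ ↦ ?_
        rw [div_eq_mul_inv, ← nsmul_eq_mul]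
        exact sum_eq_card_nsmul fun u hu ↦ by
          rw [(SimpleGraph.mem_cliqueFinset_iff.1 hu).card_eq]
    _ ≤ ∑ j ∈ range 5, L ^ 4 * ρ ^ 4 := by
        refine sum_le_sum fun j hj ↦ ?_
        rw [div_le_iff₀ (by positivity)]
        exact card_le (Nat.le_of_lt_succ (mem_range.1 hj))
    _ = 5 * (L ^ 4 * ρ ^ 4) := by simp

end SmallCliques

section Typical

variable {V : Type*} [Fintype V] {p : unitInterval} {θ : ℝ}

theorem isPseudorandom_of_card_lt {G : SimpleGraph V} (hθ : 1 ≤ θ) (hV : θ ^ 3 = Fintype.card V)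
    (hp : (p : ℝ) = θ⁻¹) (hlog : 1 ≤ Real.log (Fintype.card V))
    (hS : ∀ S : Finset V, (#(commonNeighborFinset G S) : ℝ) <
      9 * (Fintype.card V * (p : ℝ) ^ #S) + (#S + 1) * Real.log (Fintype.card V))
    (hAB : ∀ A B : Finset V, (#(G.interedges A B) : ℝ) <
      2 * (9 * (#A * #B * (p : ℝ)) + (#A + #B + 1) * Real.log (Fintype.card V))) :
    IsPseudorandom G θ (18 * Real.log (Fintype.card V)) := by
  have hθ0 : 0 < θ := by positivity
  refine ⟨hθ0, fun S card_S ↦ (hS S).le.trans ?_, fun A B ↦ ?_⟩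
  · have mean_eq : Fintype.card V * (p : ℝ) ^ #S = θ ^ (3 - #S) := by
      rw [← hV, hp, inv_pow, pow_sub₀ _ hθ0.ne' card_S]
    have one_le : 1 ≤ θ ^ (3 - #S) := one_le_pow₀ hθ
    have card_S' : (#S : ℝ) ≤ 3 := mod_cast card_S
    rw [mean_eq]
    nlinarith
  · obtain rfl | hA := A.eq_empty_or_nonempty
    · simp only [SimpleGraph.interedges_empty_left, card_empty, Nat.cast_zero]
      positivity
    have one_le_card : (1 : ℝ) ≤ #A := mod_cast hA.card_pos
    refine (hAB A B).le.trans ?_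
    rw [hp, ← div_eq_mul_inv]
    calc 2 * (9 * (#A * #B / θ) + (#A + #B + 1) * Real.log (Fintype.card V))
        ≤ 2 * (9 * (Real.log (Fintype.card V) * (#A * #B / θ)) +
            (#A + #B + #A) * Real.log (Fintype.card V)) := by
          gcongr
          exact le_mul_of_one_le_left (by positivity) hlog
      _ ≤ 18 * Real.log (Fintype.card V) * (#A * #B / θ + #A + #B) := by
          have hA0 : 0 ≤ Real.log (Fintype.card V) * #A := by positivity
          have hB0 : 0 ≤ Real.log (Fintype.card V) * #B := by positivity
          linarith

theorem one_le_log {n : ℕ} (hn : 3 ≤ n) : 1 ≤ Real.log n := by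
  rw [Real.le_log_iff_exp_le (by positivity)]
  exact (Real.exp_one_lt_d9.le.trans (by norm_num)).trans (Nat.cast_le.2 hn)

theorem binomialRandom_real_not_isPseudorandom_le [Nonempty V] (hθ : 1 ≤ θ)
    (hV : θ ^ 3 = Fintype.card V) (hp : (p : ℝ) = θ⁻¹) (hlog : 1 ≤ Real.log (Fintype.card V)) :
    G(V, p).real {G | ¬ IsPseudorandom G θ (18 * Real.log (Fintype.card V))} ≤
      Real.exp 1 / Fintype.card V + Real.exp 1 ^ 2 / Fintype.card V := by
  let manyCommonNeighbors : Set (SimpleGraph V) := {G | ∃ S : Finset V,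
    9 * (Fintype.card V * (p : ℝ) ^ #S) + (#S + 1) * Real.log (Fintype.card V) ≤
      #(commonNeighborFinset G S)}
  let manyEdges : Set (SimpleGraph V) := {G | ∃ A B : Finset V,
    2 * (9 * (#A * #B * (p : ℝ)) + (#A + #B + 1) * Real.log (Fintype.card V)) ≤
      #(G.interedges A B)}
  have subset_union : {G | ¬ IsPseudorandom G θ (18 * Real.log (Fintype.card V))} ⊆
      manyCommonNeighbors ∪ manyEdges := by
    intro G hG
    by_contra h
    simp only [Set.mem_union, not_or, manyCommonNeighbors, manyEdges, Set.mem_ofPred_eq,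
      not_exists, not_le] at h
    exact hG (isPseudorandom_of_card_lt hθ hV hp hlog h.1 h.2)
  calc G(V, p).real {G | ¬ IsPseudorandom G θ (18 * Real.log (Fintype.card V))}
      ≤ G(V, p).real (manyCommonNeighbors ∪ manyEdges) :=
        measureReal_mono subset_union (measure_ne_top _ _)
    _ ≤ G(V, p).real manyCommonNeighbors + G(V, p).real manyEdges := measureReal_union_le _ _
    _ ≤ Real.exp 1 / Fintype.card V + Real.exp 1 ^ 2 / Fintype.card V :=
        add_le_add binomialRandom_real_exists_le_card_commonNeighborFinset_le
          binomialRandom_real_exists_le_card_interedges_le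

theorem one_sub_le_binomialRandom_real_isPseudorandom [DecidableEq V]
    (hθ : 1 ≤ θ) (hV : θ ^ 3 = Fintype.card V) (hp : (p : ℝ) = θ⁻¹)
    (card_V : 6 ≤ Fintype.card V) :
    1 - 9437200 / Fintype.card V ≤ G(V, p).real {G |
      IsPseudorandom G θ (18 * Real.log (Fintype.card V)) ∧
        θ ^ 6 ≤ 768 * #(G.cliqueFinset 4)} := by
  have : Nonempty V := Fintype.card_pos_iff.1 (by omega)
  set good : Set (SimpleGraph V) := {G | IsPseudorandom G θ (18 * Real.log (Fintype.card V)) ∧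
    θ ^ 6 ≤ 768 * #(G.cliqueFinset 4)}
  let notPseudorandom : Set (SimpleGraph V) :=
    {G | ¬ IsPseudorandom G θ (18 * Real.log (Fintype.card V))}
  let fewCliques : Set (SimpleGraph V) :=
    {G | #(G.cliqueFinset 4) ≤ (Fintype.card V : ℝ) ^ 2 / 768}
  have compl_subset : goodᶜ ⊆ notPseudorandom ∪ fewCliques := by
    intro G hG
    refine (not_and_or.1 hG).imp_right fun few ↦ ?_
    simp only [fewCliques, Set.mem_ofPred_eq, ← hV]
    linarith
  have bad_le : G(V, p).real goodᶜ ≤ 9437200 / Fintype.card V :=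
    calc G(V, p).real goodᶜ
        ≤ G(V, p).real (notPseudorandom ∪ fewCliques) :=
          measureReal_mono compl_subset (measure_ne_top _ _)
      _ ≤ G(V, p).real notPseudorandom + G(V, p).real fewCliques := measureReal_union_le _ _
      _ ≤ Real.exp 1 / Fintype.card V + Real.exp 1 ^ 2 / Fintype.card V +
            9437184 / Fintype.card V :=
          add_le_add
            (binomialRandom_real_not_isPseudorandom_le hθ hV hp (one_le_log (by omega)))
            (binomialRandom_real_card_cliqueFinset_four_le_le (by rw [hp, inv_pow, hV]) card_V)
      _ ≤ 9437200 / Fintype.card V := by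
          rw [← add_div, ← add_div]
          gcongr
          nlinarith [Real.exp_one_lt_d9, Real.exp_pos 1]
  rw [probReal_compl_eq_one_sub .of_discrete] at bad_le
  linarith

end Typical

section Norms

theorem eval_smul_of_isHomogeneous {σ R : Type*} [CommSemiring R] {f : MvPolynomial σ R} {d : ℕ}
    (hf : f.IsHomogeneous d) (c : R) (x : σ → R) :
    MvPolynomial.eval (c • x) f = c ^ d * MvPolynomial.eval x f := by
  rw [MvPolynomial.eval_eq, MvPolynomial.eval_eq, mul_sum]
  refine sum_congr rfl fun α hα ↦ ?_
  have degree_eq : ∑ i ∈ α.support, α i = d := by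
    rw [← Finsupp.degree_apply, Finsupp.degree_eq_weight_one]
    exact hf (MvPolynomial.mem_support_iff.1 hα)
  simp only [Pi.smul_apply, smul_eq_mul, mul_pow, prod_mul_distrib, prod_pow_eq_pow_sum,
    degree_eq]
  ring

variable {n : ℕ} {h : MvPolynomial (Fin n) ℝ}

theorem abs_eval_le_sphereNorm (h : MvPolynomial (Fin n) ℝ) {x : EuclideanSpace ℝ (Fin n)}
    (hx : ‖x‖ = 1) : |MvPolynomial.eval x h| ≤ sphereNorm h := by
  have continuous_eval : Continuous fun x : Metric.sphere (0 : EuclideanSpace ℝ (Fin n)) 1 ↦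
      |MvPolynomial.eval (fun i ↦ (x : EuclideanSpace ℝ (Fin n)) i) h| := by
    refine (h.continuous_eval.comp ?_).abs
    fun_prop
  exact le_ciSup (isCompact_range continuous_eval).bddAbove ⟨x, mem_sphere_zero_iff_norm.2 hx⟩

theorem sphereNorm_le {r : ℝ} (hr : 0 ≤ r)
    (h_le : ∀ x : EuclideanSpace ℝ (Fin n), ‖x‖ = 1 → |MvPolynomial.eval x h| ≤ r) :
    sphereNorm h ≤ r :=
  Real.iSup_le (fun x ↦ h_le x (norm_eq_of_mem_sphere x)) hr

theorem sphereNorm_nonneg (h : MvPolynomial (Fin n) ℝ) : 0 ≤ sphereNorm h :=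
  Real.iSup_nonneg fun _ ↦ abs_nonneg _

theorem sphereNorm_pow_le (h : MvPolynomial (Fin n) ℝ) (m : ℕ) :
    sphereNorm (h ^ m) ≤ sphereNorm h ^ m := by
  refine sphereNorm_le (pow_nonneg (sphereNorm_nonneg h) m) fun x hx ↦ ?_
  rw [map_pow, abs_pow]
  gcongr
  exact abs_eval_le_sphereNorm h hx

theorem sphereNorm_pos {d : ℕ} (hh : h.IsHomogeneous d) {x : EuclideanSpace ℝ (Fin n)}
    (hx : x ≠ 0) (eval_ne : MvPolynomial.eval x h ≠ 0) : 0 < sphereNorm h := by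
  refine lt_of_lt_of_le ?_ (abs_eval_le_sphereNorm h (norm_smul_inv_norm (𝕜 := ℝ) hx))
  rw [WithLp.ofLp_smul, eval_smul_of_isHomogeneous hh, abs_pos]
  exact mul_ne_zero (pow_ne_zero d (by simpa using hx)) eval_ne

theorem div_pow_le_spNorm_div_sphereNorm {a b : ℝ} {d m : ℕ} (ha : 0 ≤ a)
    (le_spNorm : a ^ m ≤ spNorm d (h ^ m)) (pos : 0 < sphereNorm (h ^ m))
    (le_b : sphereNorm h ≤ b) :
    (a / b) ^ m ≤ spNorm d (h ^ m) / sphereNorm (h ^ m) := by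
  have pow_le : sphereNorm (h ^ m) ≤ b ^ m :=
    (sphereNorm_pow_le h m).trans (pow_le_pow_left₀ (sphereNorm_nonneg h) le_b m)
  rw [div_pow]
  exact div_le_div₀ ((pow_nonneg ha m).trans le_spNorm) le_spNorm pos pow_le

theorem div_le_spNorm_rpow_inv_div_sphereNorm {a b : ℝ} {d m : ℕ} (hm : m ≠ 0) (ha : 0 ≤ a)
    (le_spNorm : a ^ m ≤ spNorm d (h ^ m)) (pos : 0 < sphereNorm h) (le_b : sphereNorm h ≤ b) :
    a / b ≤ spNorm d (h ^ m) ^ (m : ℝ)⁻¹ / sphereNorm h := by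
  have le_root : a ≤ spNorm d (h ^ m) ^ (m : ℝ)⁻¹ :=
    (Real.pow_rpow_inv_natCast ha hm).symm.trans_le
      (Real.rpow_le_rpow (pow_nonneg ha m) le_spNorm (by positivity))
  exact div_le_div₀ (ha.trans le_root) le_root pos le_b

theorem sphereNorm_cliquePoly_pow_pos {G : SimpleGraph (Fin n)}
    (hG : (G.cliqueFinset 4).Nonempty) (m : ℕ) : 0 < sphereNorm (cliquePoly G ^ m) := by
  obtain ⟨s, hs⟩ := hG
  obtain ⟨i, -⟩ : s.Nonempty :=
    card_pos.1 ((SimpleGraph.mem_cliqueFinset_iff.1 hs).card_eq ▸ four_pos)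
  refine sphereNorm_pos (cliquePoly_isHomogeneous.pow m) (x := WithLp.toLp 2 fun _ ↦ 1)
    (fun h ↦ one_ne_zero (congrArg (· i) h)) ?_
  rw [map_pow, eval_one_cliquePoly]
  exact pow_ne_zero m (Nat.cast_ne_zero.2 (card_ne_zero_of_mem hs))

variable {G : SimpleGraph (Fin n)} {ρ L : ℝ}

theorem IsPseudorandom.div_pow_le_spNorm_cliquePoly (hG : IsPseudorandom G (ρ ^ 2) L)
    (hρ : 1 ≤ ρ) (hL : 1 ≤ L) (le_card : (ρ ^ 2) ^ 6 ≤ 768 * #(G.cliqueFinset 4)) {m : ℕ} {a : ℝ}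
    (ha : 0 < a) (le_sq : 3840 * (4 * m) ^ 6 * L ^ 4 ≤ a ^ 2) :
    (ρ / a) ^ m ≤ spNorm (4 * m) (cliquePoly G ^ m) := by
  refine le_spNorm ⟨2 * m, by ring⟩ (cliquePoly_isHomogeneous.pow m) fun M hM ↦ ?_
  set μ := ‖Matrix.toEuclideanCLM (𝕜 := ℝ) M‖
  have sum_le := hG.sum_smallCliques_le hρ hL
  have sq_pow_le : (ρ ^ 2) ^ m ≤ (a ^ 2) ^ m * μ ^ 2 := by
    refine le_of_mul_le_mul_right ?_ (by positivity : 0 < (ρ ^ 10) ^ m)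
    calc (ρ ^ 2) ^ m * (ρ ^ 10) ^ m = ((ρ ^ 2) ^ 6) ^ m := by
          rw [← mul_pow]
          ring
      _ ≤ (768 * #(G.cliqueFinset 4) : ℝ) ^ m := by gcongr
      _ = (768 : ℝ) ^ m * (#(G.cliqueFinset 4) : ℝ) ^ m := mul_pow _ _ _
      _ ≤ 768 ^ m * (((4 * m) ^ 6 * (ρ ^ 3) ^ 2 * (5 * (L ^ 4 * ρ ^ 4))) ^ m * μ ^ 2) := by
          gcongr
          refine (hM.card_cliqueFinset_four_pow_le (z := ρ ^ 3) (by positivity)).trans ?_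
          gcongr
      _ = (3840 * (4 * m) ^ 6 * L ^ 4 * ρ ^ 10) ^ m * μ ^ 2 := by
          rw [← mul_assoc, ← mul_pow]
          congr 2
          ring
      _ ≤ (a ^ 2 * ρ ^ 10) ^ m * μ ^ 2 := by gcongr
      _ = (a ^ 2) ^ m * μ ^ 2 * (ρ ^ 10) ^ m := by rw [mul_pow, mul_right_comm]
  refine (sq_le_sq₀ (by positivity) (norm_nonneg _)).1 ?_
  rw [div_pow, div_pow, pow_right_comm, pow_right_comm a, div_le_iff₀' (by positivity)]
  exact sq_pow_le

theorem lt_four_pow_floor_log_add_one {n : ℕ} (hn : n ≠ 0) : n < 4 ^ (⌊Real.log n⌋₊ + 1) := by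
  have exp_le : Real.exp 1 ≤ 4 := Real.exp_one_lt_d9.le.trans (by norm_num)
  suffices (n : ℝ) < 4 ^ (⌊Real.log n⌋₊ + 1) from mod_cast this
  calc (n : ℝ) = Real.exp (Real.log n) := (Real.exp_log (mod_cast hn.pos)).symm
    _ < Real.exp ((⌊Real.log n⌋₊ + 1 : ℕ) : ℝ) := by
        rw [Nat.cast_add_one]
        exact Real.exp_lt_exp.2 (Nat.lt_floor_add_one _)
    _ = Real.exp 1 ^ (⌊Real.log n⌋₊ + 1) := by rw [← Real.exp_nat_mul, mul_one]
    _ ≤ 4 ^ (⌊Real.log n⌋₊ + 1) := by gcongr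

theorem IsPseudorandom.sphereNorm_cliquePoly_le (hn : 3 ≤ n)
    (hG : IsPseudorandom G (ρ ^ 2) (18 * Real.log n)) :
    sphereNorm (cliquePoly G) ≤ 4 ^ 13 * Real.log n ^ 6 := by
  have : NeZero n := ⟨by omega⟩
  have one_le := one_le_log hn
  have floor_add_one_le : (⌊Real.log n⌋₊ : ℝ) + 1 ≤ 2 * Real.log n := by
    linarith [Nat.floor_le (zero_le_one.trans one_le)]
  refine sphereNorm_le (by positivity) fun x hx ↦ ?_
  have sum_sq : ∑ i, x i ^ 2 = 1 := by
    rw [← EuclideanSpace.real_norm_sq_eq, hx, one_pow]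
  rw [eval_cliquePoly]
  calc |∑ s ∈ G.cliqueFinset 4, ∏ i ∈ s, x i|
      ≤ 972 * (18 * Real.log n) ^ 3 * ((⌊Real.log n⌋₊ + 1 : ℕ) : ℝ) ^ 3 :=
        hG.abs_sum_cliqueFinset_four_prod_le
          (by simpa using lt_four_pow_floor_log_add_one (NeZero.ne n)) sum_sq
    _ ≤ 972 * (18 * Real.log n) ^ 3 * (2 * Real.log n) ^ 3 := by
        push_cast
        gcongr
    _ ≤ 4 ^ 13 * Real.log n ^ 6 := by
        ring_nf
        gcongr
        norm_num

end Norms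

section RandomGraph

variable {n : ℕ}

theorem coe_edgeProb (n : ℕ) : (edgeProb n : ℝ) = (((n : ℝ) ^ (1 / 6 : ℝ)) ^ 2)⁻¹ := by
  rw [← Real.rpow_mul_natCast n.cast_nonneg, ← Real.rpow_neg n.cast_nonneg]
  norm_num [edgeProb]

instance : IsProbabilityMeasure (randomGraph n) :=
  inferInstanceAs (IsProbabilityMeasure G(Fin n, edgeProb n))

theorem one_sub_le_randomGraph_real_isPseudorandom (hn : 6 ≤ n) :
    1 - 9437200 / (n : ℝ) ≤ (randomGraph n).real {G |
      IsPseudorandom G (((n : ℝ) ^ (1 / 6 : ℝ)) ^ 2) (18 * Real.log n) ∧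
        (((n : ℝ) ^ (1 / 6 : ℝ)) ^ 2) ^ 6 ≤ 768 * #(G.cliqueFinset 4)} := by
  have one_le : 1 ≤ ((n : ℝ) ^ (1 / 6 : ℝ)) ^ 2 :=
    one_le_pow₀ (Real.one_le_rpow (mod_cast (by omega : 1 ≤ n)) (by norm_num))
  have cube_eq : (((n : ℝ) ^ (1 / 6 : ℝ)) ^ 2) ^ 3 = Fintype.card (Fin n) := by
    rw [← pow_mul, ← Real.rpow_mul_natCast n.cast_nonneg, Fintype.card_fin]
    norm_num
  simpa only [randomGraph, Fintype.card_fin] using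
    one_sub_le_binomialRandom_real_isPseudorandom one_le cube_eq (coe_edgeProb n)
      ((Fintype.card_fin n).symm ▸ hn)

variable {G : SimpleGraph (Fin n)} {ρ : ℝ} {m : ℕ}

theorem IsPseudorandom.div_log_pow_le_spNorm_cliquePoly (hn : 3 ≤ n) (hm : 1 ≤ m) (hρ : 1 ≤ ρ)
    (hG : IsPseudorandom G (ρ ^ 2) (18 * Real.log n))
    (le_card : (ρ ^ 2) ^ 6 ≤ 768 * #(G.cliqueFinset 4)) :
    (ρ / (4 * m * Real.log n) ^ 11) ^ m ≤ spNorm (4 * m) (cliquePoly G ^ m) := by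
  have one_le := one_le_log hn
  have one_le_m : (1 : ℝ) ≤ m := mod_cast hm
  have four_le : 4 ≤ 4 * m * Real.log n := by nlinarith
  refine hG.div_pow_le_spNorm_cliquePoly hρ (by linarith) le_card (by positivity) ?_
  calc 3840 * (4 * m : ℝ) ^ 6 * (18 * Real.log n) ^ 4
      ≤ 4 ^ 16 * ((4 * m) ^ 6 * Real.log n ^ 4) := by
        rw [mul_pow 18]
        nlinarith [show 0 ≤ (4 * m : ℝ) ^ 6 * Real.log n ^ 4 by positivity]
    _ ≤ 4 ^ 16 * ((4 * m) ^ 6 * Real.log n ^ 6) := by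
        gcongr 4 ^ 16 * (_ * ?_)
        exact pow_le_pow_right₀ one_le (by norm_num)
    _ = 4 ^ 16 * (4 * m * Real.log n) ^ 6 := by rw [mul_pow (4 * m : ℝ)]
    _ ≤ (4 * m * Real.log n) ^ 16 * (4 * m * Real.log n) ^ 6 := by gcongr
    _ = ((4 * m * Real.log n) ^ 11) ^ 2 := by rw [← pow_add, ← pow_mul]

theorem IsPseudorandom.sphereNorm_cliquePoly_le_pow (hn : 3 ≤ n) (hm : 1 ≤ m)
    (hG : IsPseudorandom G (ρ ^ 2) (18 * Real.log n)) :
    sphereNorm (cliquePoly G) ≤ (4 * m * Real.log n) ^ 19 := by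
  have one_le := one_le_log hn
  have one_le_m : (1 : ℝ) ≤ m := mod_cast hm
  calc sphereNorm (cliquePoly G) ≤ 4 ^ 13 * Real.log n ^ 6 := hG.sphereNorm_cliquePoly_le hn
    _ ≤ (4 * m * Real.log n) ^ 13 * (4 * m * Real.log n) ^ 6 := by
        gcongr <;> nlinarith
    _ = (4 * m * Real.log n) ^ 19 := by rw [← pow_add]

theorem IsPseudorandom.div_log_pow_le_spNorm_div_sphereNorm (hn : 3 ≤ n) (hm : 1 ≤ m)
    (hρ : 1 ≤ ρ) (hG : IsPseudorandom G (ρ ^ 2) (18 * Real.log n))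
    (le_card : (ρ ^ 2) ^ 6 ≤ 768 * #(G.cliqueFinset 4)) :
    (ρ / (4 * m * Real.log n) ^ 30) ^ m ≤
        spNorm (4 * m) (cliquePoly G ^ m) / sphereNorm (cliquePoly G ^ m) ∧
      ρ / (4 * m * Real.log n) ^ 30 ≤
        spNorm (4 * m) (cliquePoly G ^ m) ^ (m : ℝ)⁻¹ / sphereNorm (cliquePoly G) := by
  have le_spNorm := hG.div_log_pow_le_spNorm_cliquePoly hn hm hρ le_card
  have sphereNorm_le := hG.sphereNorm_cliquePoly_le_pow hn hm
  have cliques_nonempty : (G.cliqueFinset 4).Nonempty := by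
    refine card_pos.1 (Nat.cast_pos (α := ℝ).1 ?_)
    linarith [show 0 < (ρ ^ 2) ^ 6 by positivity]
  have sphereNorm_pos := sphereNorm_cliquePoly_pow_pos cliques_nonempty
  have nonneg : 0 ≤ ρ / (4 * m * Real.log n) ^ 11 := by
    have := one_le_log hn
    positivity
  rw [show 30 = 11 + 19 from rfl, pow_add, ← div_div]
  exact ⟨div_pow_le_spNorm_div_sphereNorm nonneg le_spNorm (sphereNorm_pos m) sphereNorm_le,
    div_le_spNorm_rpow_inv_div_sphereNorm (by omega) nonneg le_spNorm
      (by simpa only [pow_one] using sphereNorm_pos 1) sphereNorm_le⟩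

end RandomGraph

theorem mainTheorem4 :
    ∃ (C : ℕ) (K : ℝ), ∀ n : ℕ, 2 ≤ n →
      1 - K / (n : ℝ) ≤ (randomGraph n).real {G : SimpleGraph (Fin n) |
        ∀ q : ℕ, 0 < q → 4 ∣ q →
          (n : ℝ) ^ ((q : ℝ) / 24) / ((q : ℝ) * Real.log n) ^ (C * q) ≤
            spNorm q (cliquePoly G ^ (q / 4)) / sphereNorm (cliquePoly G ^ (q / 4)) ∧
          (n : ℝ) ^ ((1 : ℝ) / 6) / ((q : ℝ) * Real.log n) ^ C ≤
            spNorm q (cliquePoly G ^ (q / 4)) ^ (4 / (q : ℝ)) / sphereNorm (cliquePoly G)} := by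
  refine ⟨30, 9437200, fun n hn ↦ ?_⟩
  obtain n_lt | le_n := lt_or_ge n 6
  · refine le_trans ?_ measureReal_nonneg
    rw [sub_nonpos, le_div_iff₀ (by positivity)]
    linarith [show (n : ℝ) < 6 from mod_cast n_lt]
  refine (one_sub_le_randomGraph_real_isPseudorandom le_n).trans
    (measureReal_mono ?_ (measure_ne_top _ _))
  rintro G ⟨hG, le_card⟩ q hq ⟨m, rfl⟩
  have hm : 1 ≤ m := by omega
  have one_le_m : (1 : ℝ) ≤ m := mod_cast hm
  have one_le_base : 1 ≤ 4 * m * Real.log n := by nlinarith [one_le_log (by omega : 3 ≤ n)]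
  have pow_eq : (n : ℝ) ^ (4 * m / 24 : ℝ) = ((n : ℝ) ^ (1 / 6 : ℝ)) ^ m := by
    rw [← Real.rpow_mul_natCast n.cast_nonneg]
    ring_nf
  have inv_eq : 4 / (4 * m : ℝ) = (m : ℝ)⁻¹ := by field_simp
  obtain ⟨pow_le, root_le⟩ := hG.div_log_pow_le_spNorm_div_sphereNorm (by omega) hm
    (Real.one_le_rpow (mod_cast (by omega : 1 ≤ n)) (by norm_num)) le_card
  rw [Nat.mul_div_cancel_left m four_pos, Nat.cast_mul, Nat.cast_ofNat, pow_eq, inv_eq]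
  refine ⟨le_trans ?_ pow_le, root_le⟩
  rw [div_pow, ← pow_mul]
  exact div_le_div_of_nonneg_left (by positivity) (by positivity)
    (pow_le_pow_right₀ one_le_base (by omega))
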